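/- Let $G$ be a simply connected nilpotent Lie group and let $\Gamma,\Gamma'\subset G$ be cocompact discrete subgroups with homomorphisms $\varepsilon:\Gamma\to\{-1,1\}$ and $\varepsilon':\Gamma'\to\{-1,1\}$. Let $L^2_\varepsilon(\Gamma\backslash G)$ be the Hilbert space of (classes of) locally square-integrable functions $f:G\to\mathbb C$ with $f(g_0g)=\varepsilon(g_0)f(g)$ for all $g_0\in\Gamma$, $g\in G$, with norm $\|f\|^2=\int_{\Gamma\backslash G}|f|^2$, on which $G$ acts by the right regular representation $(R(h)f)(g)=f(gh)$; and similarly for $(\Gamma',\varepsilon')$. Assume that $(\Gamma,\varepsilon)$ and $(\Gamma',\varepsilon')$ are representation equivalent, i.e. that there is a linear homeomorphism $L^2_\varepsilon(\Gamma\backslash G)\to L^2_{\varepsilon'}(\Gamma'\backslash G)$ commuting with the actions of $G$. Let $\langle\cdot,\cdot\rangle$ be any left-invariant Riemannian metric on $G$, let $n=\dim G$, let $e_1,\dots,e_n$ be an orthonormal basis of the Lie algebra (regarded as left-invariant vector fields), let $\Gamma_{ij}^k=\langle\nabla_{e_i}e_j,e_k\rangle$ be the Christoffel symbols of the Levi-Civita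 connection, and let $\Sigma_n$ be a complex spinor module of dimension $2^{\lfloor n/2\rfloor}$ with Clifford multiplications $\gamma(E_1),\dots,\gamma(E_n)$ (skew-Hermitian, $\gamma(E_i)\gamma(E_j)+\gamma(E_j)\gamma(E_i)=-2\delta_{ij}$). Spinor fields on $\Gamma\backslash G$ with the spin structure given by $\varepsilon$ are the maps $\sigma:G\to\Sigma_n$ with $\sigma(g_0g)=\varepsilon(g_0)\sigma(g)$ for all $g_0\in\Gamma$, $g\in G$, and the Dirac operator is $$D\sigma=\sum_{i=1}^n\gamma(E_i)\Big(\partial_{e_i}\sigma+\tfrac14\sum_{j,k=1}^n\Gamma_{ij}^k\,\gamma(E_j)\gamma(E_k)\sigma\Big)$$ on smooth spinor fields; denote by $D_{\Gamma,\varepsilon}$ its closure in the Hilbert space of square-integrable spinor fields on $\Gamma\backslash G$. Define $D_{\Gamma',\varepsilon'}$ in the same way. Then $D_{\Gamma,\varepsilon}$ and $D_{\Gamma',\varepsilon'}$ have the same spectrum, with multiplicities: their spectra coincide as subsets of $\mathbb C$, and for every $z\in\mathbb C$ the spaces $\ker(D_{\Gamma,\varepsilon}-z)$ and $\ker(D_{\Gamma',\varepsilon'}-z)$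 have the same dimension. -/

import Mathlib

open MeasureTheory Set
open scoped Manifold ContDiff Pointwise Topology

set_option linter.unusedSectionVars false

noncomputable section

namespace DiracNil

section EquivariantFunctions

variable {G : Type*} [Group G] [TopologicalSpace G] [IsTopologicalGroup G] [T2Space G]
  [LocallyCompactSpace G] [SecondCountableTopology G] [MeasurableSpace G] [BorelSpace G]

/-- If `Γ \ G` is compact, then some compact subset of `G` meets every coset `Γ g`. -/
theorem exists_compact_meets (Γ : Subgroup G)
    [CompactSpace (Quotient (QuotientGroup.rightRel Γ))] :
    ∃ K : Set G, IsCompact K ∧ ∀ g : G, ∃ γ : Γ, γ • g ∈ K := by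
  let π : G → Quotient (QuotientGroup.rightRel Γ) := Quotient.mk _
  have hπ : IsOpenMap π := isOpenMap_quotient_mk'_mul (Γ := Γ) (T := G)
  choose C hC hCn using fun g : G => exists_compact_mem_nhds g
  obtain ⟨t, ht⟩ := (isCompact_univ (X := Quotient (QuotientGroup.rightRel Γ))).elim_finite_subcover
    (fun g : G => π '' interior (C g)) (fun g => hπ _ isOpen_interior) (by
      intro q _
      obtain ⟨g, rfl⟩ := Quotient.exists_rep q
      exact mem_iUnion.2 ⟨g, g, mem_interior_iff_mem_nhds.2 (hCn g), rfl⟩)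
  refine ⟨⋃ g ∈ t, C g, t.isCompact_biUnion fun g _ => hC g, fun g => ?_⟩
  have := ht (mem_univ (π g))
  simp only [mem_iUnion] at this
  obtain ⟨a, hat, x, hx, hxg⟩ := this
  obtain ⟨γ, hγ⟩ : ∃ γ : Γ, γ • g = x := by
    have := Quotient.exact hxg
    exact this
  exact ⟨γ, mem_biUnion hat (hγ ▸ interior_subset hx)⟩

/-- A discrete cocompact subgroup has a relatively compact fundamental domain. -/
theorem exists_fundamentalDomain (μ : Measure G) (Γ : Subgroup G) [DiscreteTopology Γ]
    [CompactSpace (Quotient (QuotientGroup.rightRel Γ))] :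
    ∃ F : Set G, (∃ K, IsCompact K ∧ F ⊆ K) ∧ IsFundamentalDomain Γ F μ := by
  obtain ⟨K, hK, hKΓ⟩ := exists_compact_meets Γ
  obtain ⟨W, hW, hWΓ⟩ : ∃ W : Set G, IsOpen W ∧ (Subtype.val ⁻¹' W : Set Γ) = {1} :=
    isOpen_induced_iff.1 (isOpen_discrete ({1} : Set Γ))
  have h1W : (1 : G) ∈ W := by
    have : (1 : Γ) ∈ (Subtype.val ⁻¹' W : Set Γ) := by rw [hWΓ]; rfl
    exact this
  obtain ⟨U', hU', hUW'⟩ := exists_nhds_split_inv (hW.mem_nhds h1W)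
  obtain ⟨U, hUU', hU, h1U⟩ := mem_nhds_iff.1 hU'
  have hUW : ∀ p ∈ U, ∀ q ∈ U, p / q ∈ W := fun p hp q hq => hUW' p (hUU' hp) q (hUU' hq)
  have hopen : ∀ x : G, IsOpen {g : G | g * x⁻¹ ∈ U} := fun x =>
    hU.preimage (continuous_id.mul continuous_const)
  obtain ⟨s, hs, hsU⟩ := TopologicalSpace.countable_cover_nhds
    (f := fun x : G => {g : G | g * x⁻¹ ∈ U}) (fun x => (hopen x).mem_nhds (by simpa using h1U))
  have hsne : s.Nonempty := by
    have : (1 : G) ∈ ⋃ x ∈ s, {g : G | g * x⁻¹ ∈ U} := by rw [hsU]; trivial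
    simp only [mem_iUnion] at this
    obtain ⟨x, hx, -⟩ := this
    exact ⟨x, hx⟩
  obtain ⟨x, rfl⟩ := hs.exists_eq_range hsne
  have hcov : ∀ g : G, ∃ i, g * (x i)⁻¹ ∈ U := by
    intro g
    have : g ∈ ⋃ y ∈ range x, {g : G | g * y⁻¹ ∈ U} := by rw [hsU]; trivial
    simpa using this
  let A : ℕ → Set G := fun i => K ∩ {g | g * (x i)⁻¹ ∈ U}
  let B : ℕ → Set G := fun i => ⋃ γ : Γ, (fun g => γ • g) ⁻¹' A i
  have hA : ∀ i, MeasurableSet (A i) := fun i => hK.measurableSet.inter (hopen (x i)).measurableSet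
  have hcount : Countable Γ := countable_of_Lindelof_of_discrete
  have hB : ∀ i, MeasurableSet (B i) := fun i =>
    MeasurableSet.iUnion fun γ => (hA i).preimage (measurable_const_mul (γ : G))
  have hBinv : ∀ i g (γ : Γ), γ • g ∈ B i → g ∈ B i := by
    intro i g γ h
    obtain ⟨δ, hδ⟩ := mem_iUnion.1 h
    exact mem_iUnion.2 ⟨δ * γ, by simpa [mul_smul] using hδ⟩
  refine ⟨⋃ i, A i \ ⋃ j, ⋃ _ : j < i, B j, ⟨K, hK, ?_⟩, ?_⟩
  · exact iUnion_subset fun i => sdiff_subset.trans inter_subset_left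
  · refine IsFundamentalDomain.mk' (MeasurableSet.nullMeasurableSet (MeasurableSet.iUnion fun i =>
      (hA i).diff (MeasurableSet.iUnion fun j => MeasurableSet.iUnion fun _ => hB j))) fun g => ?_
    have hg : ∃ i, g ∈ B i := by
      obtain ⟨γ, hγ⟩ := hKΓ g
      obtain ⟨i, hi⟩ := hcov (γ • g)
      exact ⟨i, mem_iUnion.2 ⟨γ, hγ, hi⟩⟩
    classical
    obtain ⟨γ, hγ⟩ := mem_iUnion.1 (Nat.find_spec hg)
    have key : ∀ δ : Γ, δ • g ∈ (⋃ i, A i \ ⋃ j, ⋃ _ : j < i, B j) → δ • g ∈ A (Nat.find hg) := by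
      intro δ hδ
      obtain ⟨i, hi, hin⟩ := mem_iUnion.1 hδ
      have h1 : Nat.find hg ≤ i := Nat.find_min' hg (mem_iUnion.2 ⟨δ, hi⟩)
      rcases h1.eq_or_lt with h | h
      · rw [h]; exact hi
      · exfalso
        apply hin
        refine mem_iUnion.2 ⟨Nat.find hg, mem_iUnion.2 ⟨h, hBinv _ _ δ⁻¹ ?_⟩⟩
        simpa using Nat.find_spec hg
    have hmem : γ • g ∈ (⋃ i, A i \ ⋃ j, ⋃ _ : j < i, B j) := by
      refine mem_iUnion.2 ⟨Nat.find hg, hγ, fun h => ?_⟩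
      simp only [mem_iUnion] at h
      obtain ⟨j, hj, hjB⟩ := h
      exact Nat.find_min hg hj (hBinv _ _ γ hjB)
    refine ⟨γ, hmem, fun δ hδ => ?_⟩
    have h1 := (key δ hδ).2
    have h2 := hγ.2
    have h3 := hUW _ h1 _ h2
    have h4 : (δ • g * (x (Nat.find hg))⁻¹) / (γ • g * (x (Nat.find hg))⁻¹)
        = ((δ * γ⁻¹ : Γ) : G) := by
      simp [Subgroup.smul_def, div_eq_mul_inv, mul_assoc]
    have h5 : δ * γ⁻¹ ∈ (Subtype.val ⁻¹' W : Set Γ) := by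
      change ((δ * γ⁻¹ : Γ) : G) ∈ W
      rw [← h4]; exact h3
    rw [hWΓ] at h5
    exact mul_inv_eq_one.1 h5


/-! ### The space of `ε`-equivariant locally square-integrable functions -/

/-- Classes (modulo almost everywhere equality) of locally square-integrable functions
`f : G → V` such that `f (γ g) = ε(γ) f(g)` for all `γ ∈ Γ`. -/
def equivL2Submodule (μ : Measure G) [μ.IsHaarMeasure] (Γ : Subgroup G) (ε : Γ →* ℤˣ)
    (V : Type*) [NormedAddCommGroup V] [InnerProductSpace ℂ V] : Submodule ℂ (G →ₘ[μ] V) where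
  carrier := {f | (∀ γ : Γ, ∀ᵐ g ∂μ, f ((γ : G) * g) = ((ε γ : ℤ) : ℂ) • f g) ∧
    ∀ K : Set G, IsCompact K → MemLp f 2 (μ.restrict K)}
  zero_mem' := by
    refine ⟨fun γ => ?_, fun K _ => ?_⟩
    · have h0 : ((0 : G →ₘ[μ] V) : G → V) =ᵐ[μ] 0 := AEEqFun.coeFn_zero
      filter_upwards [h0,
        (measurePreserving_mul_left μ (γ : G)).quasiMeasurePreserving.ae h0] with g h1 h2
      rw [h1, h2]; simp
    · exact (MemLp.zero (ε := V)).ae_eq (ae_restrict_of_ae AEEqFun.coeFn_zero.symm)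
  add_mem' := by
    rintro f h ⟨hf, hf'⟩ ⟨hh, hh'⟩
    refine ⟨fun γ => ?_, fun K hK => ?_⟩
    · have h0 := AEEqFun.coeFn_add f h
      filter_upwards [h0, hf γ, hh γ,
        (measurePreserving_mul_left μ (γ : G)).quasiMeasurePreserving.ae h0] with g h1 h2 h3 h4
      rw [h1, h4]; simp [h2, h3]
    · exact ((hf' K hK).add (hh' K hK)).ae_eq (ae_restrict_of_ae (AEEqFun.coeFn_add f h).symm)
  smul_mem' := by
    rintro c f ⟨hf, hf'⟩
    refine ⟨fun γ => ?_, fun K hK => ?_⟩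
    · have h0 := AEEqFun.coeFn_smul c f
      filter_upwards [h0, hf γ,
        (measurePreserving_mul_left μ (γ : G)).quasiMeasurePreserving.ae h0] with g h1 h2 h4
      rw [h1, h4]; simp [h2, smul_comm c]
    · exact ((hf' K hK).const_smul c).ae_eq (ae_restrict_of_ae (AEEqFun.coeFn_smul c f).symm)

/-- The space `L²_ε(Γ \ G; V)`. -/
abbrev EquivL2 (μ : Measure G) [μ.IsHaarMeasure] (Γ : Subgroup G) (ε : Γ →* ℤˣ)
    (V : Type*) [NormedAddCommGroup V] [InnerProductSpace ℂ V] : Type _ :=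
  ↥(equivL2Submodule μ Γ ε V)


/-- Local square-integrability is preserved by right translation. -/
theorem memLp_mul_right (μ : Measure G) [μ.IsHaarMeasure] {V : Type*} [NormedAddCommGroup V]
    {f : G → V} (hf : ∀ K : Set G, IsCompact K → MemLp f 2 (μ.restrict K)) (g : G) (K : Set G)
    (hK : IsCompact K) : MemLp (fun x => f (x * g)) 2 (μ.restrict K) := by
  have hmap : Measure.map (· * g) μ = Measure.haarScalarFactor (Measure.map (· * g) μ) μ • μ :=
    Measure.isMulLeftInvariant_eq_smul _ μ
  have hK' : IsCompact ((· * g⁻¹) ⁻¹' K) := by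
    have h0 : (· * g⁻¹) ⁻¹' K = (· * g) '' K := by
      ext x
      exact ⟨fun hx => ⟨x * g⁻¹, hx, by simp⟩, by rintro ⟨y, hy, rfl⟩; simpa using hy⟩
    rw [h0]
    exact hK.image (continuous_mul_const g)
  have h1 : MemLp f 2 (Measure.map (· * g) (μ.restrict K)) := by
    have h2 : Measure.map (· * g) (μ.restrict K)
        = (Measure.map (· * g) μ).restrict ((· * g⁻¹) ⁻¹' K) := by
      rw [Measure.restrict_map (measurable_mul_const g)
        (hK.measurableSet.preimage (measurable_mul_const g⁻¹))]
      congr 2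
      ext x; simp
    rw [h2, hmap, Measure.restrict_smul]
    exact (hf _ hK').smul_measure (by simp)
  exact h1.comp_of_map (measurable_mul_const g).aemeasurable

/-- Right translation `(R(g) f)(x) = f(x g)` on `L²_ε(Γ \ G; V)`. -/
def rightTranslate (μ : Measure G) [μ.IsHaarMeasure] (Γ : Subgroup G) (ε : Γ →* ℤˣ)
    (V : Type*) [NormedAddCommGroup V] [InnerProductSpace ℂ V] (g : G)
    (f : EquivL2 μ Γ ε V) : EquivL2 μ Γ ε V :=
  ⟨(f : G →ₘ[μ] V).compQuasiMeasurePreserving (· * g) (quasiMeasurePreserving_mul_right μ g), by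
    have h0 := AEEqFun.coeFn_compQuasiMeasurePreserving (f : G →ₘ[μ] V)
      (quasiMeasurePreserving_mul_right μ g)
    refine ⟨fun γ => ?_, fun K hK => ?_⟩
    · filter_upwards [h0, (quasiMeasurePreserving_mul_right μ g).ae (f.2.1 γ),
        (measurePreserving_mul_left μ (γ : G)).quasiMeasurePreserving.ae h0] with x h1 h2 h3
      rw [h3, h1]
      simpa [mul_assoc] using h2
    · exact (memLp_mul_right μ f.2.2 g K hK).ae_eq (ae_restrict_of_ae h0.symm)⟩

theorem rightTranslate_ae (μ : Measure G) [μ.IsHaarMeasure] (Γ : Subgroup G) (ε : Γ →* ℤˣ)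
    (V : Type*) [NormedAddCommGroup V] [InnerProductSpace ℂ V] (g : G)
    (f : EquivL2 μ Γ ε V) :
    (rightTranslate μ Γ ε V g f : G →ₘ[μ] V) =ᵐ[μ] fun x => (f : G →ₘ[μ] V) (x * g) :=
  AEEqFun.coeFn_compQuasiMeasurePreserving _ (quasiMeasurePreserving_mul_right μ g)

/-- The right regular representation `(R(g) f)(x) = f(x g)` of `G` on `L²_ε(Γ \ G; V)`. -/
def rightRegular (μ : Measure G) [μ.IsHaarMeasure] (Γ : Subgroup G) (ε : Γ →* ℤˣ)
    (V : Type*) [NormedAddCommGroup V] [InnerProductSpace ℂ V] :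
    Representation ℂ G (EquivL2 μ Γ ε V) where
  toFun g :=
    { toFun := rightTranslate μ Γ ε V g
      map_add' := fun f h => by
        apply Subtype.ext
        apply AEEqFun.ext
        refine (rightTranslate_ae μ Γ ε V g (f + h)).trans ?_
        refine Filter.EventuallyEq.trans ?_ (AEEqFun.coeFn_add _ _).symm
        filter_upwards [rightTranslate_ae μ Γ ε V g f, rightTranslate_ae μ Γ ε V g h,
          (quasiMeasurePreserving_mul_right μ g).ae
            (AEEqFun.coeFn_add (f : G →ₘ[μ] V) h)] with x h1 h2 h3
        rw [Pi.add_apply, h1, h2]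
        exact h3
      map_smul' := fun c f => by
        apply Subtype.ext
        apply AEEqFun.ext
        refine (rightTranslate_ae μ Γ ε V g (c • f)).trans ?_
        refine Filter.EventuallyEq.trans ?_ (AEEqFun.coeFn_smul _ _).symm
        filter_upwards [rightTranslate_ae μ Γ ε V g f,
          (quasiMeasurePreserving_mul_right μ g).ae
            (AEEqFun.coeFn_smul c (f : G →ₘ[μ] V))] with x h1 h3
        rw [Pi.smul_apply, h1]
        exact h3 }
  map_one' := by
    refine LinearMap.ext fun f => Subtype.ext (AEEqFun.ext ?_)
    refine (rightTranslate_ae μ Γ ε V 1 f).trans ?_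
    exact Filter.Eventually.of_forall fun x => by simp
  map_mul' g h := by
    refine LinearMap.ext fun f => Subtype.ext (AEEqFun.ext ?_)
    refine (rightTranslate_ae μ Γ ε V (g * h) f).trans ?_
    refine Filter.EventuallyEq.symm
      ((rightTranslate_ae μ Γ ε V g (rightTranslate μ Γ ε V h f)).trans ?_)
    filter_upwards [(quasiMeasurePreserving_mul_right μ g).ae
      (rightTranslate_ae μ Γ ε V h f)] with x hx
    simpa [mul_assoc] using hx

section Hilbert

variable (μ : Measure G) [μ.IsHaarMeasure] (Γ : Subgroup G) [DiscreteTopology Γ]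
  [CompactSpace (Quotient (QuotientGroup.rightRel Γ))] (ε : Γ →* ℤˣ)
  (V : Type*) [NormedAddCommGroup V] [InnerProductSpace ℂ V]

/-- A relatively compact fundamental domain for the action of `Γ` on `G` by left
multiplication. -/
def fundDomain : Set G := (exists_fundamentalDomain μ Γ).choose

theorem fundDomain_spec : (∃ K, IsCompact K ∧ fundDomain μ Γ ⊆ K) ∧
    IsFundamentalDomain Γ (fundDomain μ Γ) μ :=
  (exists_fundamentalDomain μ Γ).choose_spec

theorem EquivL2.memLp_fundDomain (f : EquivL2 μ Γ ε V) :
    MemLp (f : G →ₘ[μ] V) 2 (μ.restrict (fundDomain μ Γ)) := by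
  obtain ⟨⟨K, hK, hFK⟩, -⟩ := fundDomain_spec μ Γ
  exact (f.2.2 K hK).mono_measure (Measure.restrict_mono hFK le_rfl)

/-- Restriction of equivariant functions to the fundamental domain. -/
def EquivL2.restrictFundDomain :
    EquivL2 μ Γ ε V →ₗ[ℂ] Lp V 2 (μ.restrict (fundDomain μ Γ)) where
  toFun f := (EquivL2.memLp_fundDomain μ Γ ε V f).toLp _
  map_add' f h := by
    rw [← MemLp.toLp_add, MemLp.toLp_eq_toLp_iff]
    exact ae_restrict_of_ae (AEEqFun.coeFn_add (f : G →ₘ[μ] V) h)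
  map_smul' c f := by
    rw [RingHom.id_apply, ← MemLp.toLp_const_smul, MemLp.toLp_eq_toLp_iff]
    exact ae_restrict_of_ae (AEEqFun.coeFn_smul c (f : G →ₘ[μ] V))

theorem EquivL2.restrictFundDomain_injective :
    Function.Injective (EquivL2.restrictFundDomain μ Γ ε V) := by
  rw [← LinearMap.ker_eq_bot, LinearMap.ker_eq_bot']
  intro f hf
  have hcount : Countable Γ := countable_of_Lindelof_of_discrete
  have hF := (fundDomain_spec μ Γ).2
  have h0 : ((f : G →ₘ[μ] V) : G → V) =ᵐ[μ.restrict (fundDomain μ Γ)] 0 :=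
    (MemLp.coeFn_toLp (EquivL2.memLp_fundDomain μ Γ ε V f)).symm.trans
      ((Lp.eq_zero_iff_ae_eq_zero).1 hf)
  have h1 : ∀ᵐ g ∂μ, g ∈ fundDomain μ Γ → (f : G →ₘ[μ] V) g = 0 :=
    (ae_restrict_iff'₀ hF.nullMeasurableSet).1 h0
  have h2 : ∀ᵐ g ∂μ, ∀ γ : Γ, (γ : G) * g ∈ fundDomain μ Γ →
      (f : G →ₘ[μ] V) ((γ : G) * g) = 0 :=
    ae_all_iff.2 fun γ => (measurePreserving_mul_left μ (γ : G)).quasiMeasurePreserving.ae h1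
  have h3 : ((f : G →ₘ[μ] V) : G → V) =ᵐ[μ] 0 := by
    filter_upwards [hF.ae_covers, h2, ae_all_iff.2 f.2.1] with g hg h2 h3
    obtain ⟨γ, hγ⟩ := hg
    have h4 := h2 γ hγ
    rw [h3 γ] at h4
    rcases Int.units_eq_one_or (ε γ) with h | h <;> simpa [h] using h4
  apply Subtype.ext
  exact AEEqFun.ext (h3.trans AEEqFun.coeFn_zero.symm)

/-- The Hilbert norm `‖f‖² = ∫_{Γ \ G} |f|²`; the integral over the quotient is the integral over
a fundamental domain. -/
instance EquivL2.instNormedAddCommGroup : NormedAddCommGroup (EquivL2 μ Γ ε V) :=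
  NormedAddCommGroup.induced _ _ (EquivL2.restrictFundDomain μ Γ ε V)
    (EquivL2.restrictFundDomain_injective μ Γ ε V)

/-- The Hilbert space structure `⟪f, h⟫ = ∫_{Γ \ G} ⟪f, h⟫`. -/
instance EquivL2.instInnerProductSpace : InnerProductSpace ℂ (EquivL2 μ Γ ε V) where
  norm_smul_le c f := by
    change ‖EquivL2.restrictFundDomain μ Γ ε V (c • f)‖ ≤
      ‖c‖ * ‖EquivL2.restrictFundDomain μ Γ ε V f‖
    rw [map_smul]; exact norm_smul_le _ _
  inner f h := inner ℂ (EquivL2.restrictFundDomain μ Γ ε V f)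
    (EquivL2.restrictFundDomain μ Γ ε V h)
  norm_sq_eq_re_inner f :=
    norm_sq_eq_re_inner (𝕜 := ℂ) (EquivL2.restrictFundDomain μ Γ ε V f)
  conj_inner_symm f h := inner_conj_symm _ _
  add_left f h k := by rw [map_add, inner_add_left]
  smul_left f h c := by rw [map_smul, inner_smul_left]

end Hilbert

/-- `(Γ, ε)` and `(Γ', ε')` are representation equivalent: the right regular representations of
`G` on the complex-valued `L²_ε(Γ \ G)` and `L²_ε'(Γ' \ G)` are isomorphic, that is, there is
a linear homeomorphism between these Hilbert spaces which intertwines them. -/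
def RepresentationEquivalent (μ : Measure G) [μ.IsHaarMeasure]
    (Γ : Subgroup G) [DiscreteTopology Γ] [CompactSpace (Quotient (QuotientGroup.rightRel Γ))]
    (ε : Γ →* ℤˣ)
    (Γ' : Subgroup G) [DiscreteTopology Γ'] [CompactSpace (Quotient (QuotientGroup.rightRel Γ'))]
    (ε' : Γ' →* ℤˣ) : Prop :=
  ∃ θ : EquivL2 μ Γ ε ℂ ≃L[ℂ] EquivL2 μ Γ' ε' ℂ,
    ∀ (g : G) (f : EquivL2 μ Γ ε ℂ),
      θ (rightRegular μ Γ ε ℂ g f) = rightRegular μ Γ' ε' ℂ g (θ f)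

end EquivariantFunctions

/-! ### Spectra of unbounded operators -/

section Spectrum

variable {H : Type*} [NormedAddCommGroup H] [NormedSpace ℂ H]

/-- The resolvent set of the (unbounded) operator with graph `T`: those `z` for which `T - z` is a
bijection from the domain of `T` onto `H` with a bounded inverse `R`. -/
def resolventSetOfGraph (T : Submodule ℂ (H × H)) : Set ℂ :=
  {z | ∃ R : H →L[ℂ] H, ∀ f h : H, (f, h) ∈ T ↔ R (h - z • f) = f}

/-- The spectrum of the (unbounded) operator with graph `T`. -/
def spectrumOfGraph (T : Submodule ℂ (H × H)) : Set ℂ := (resolventSetOfGraph T)ᶜ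

/-- The eigenspace `{f | T f = z f}` of the (unbounded) operator with graph `T`. -/
def eigenspaceOfGraph (T : Submodule ℂ (H × H)) (z : ℂ) : Submodule ℂ H :=
  T.comap (LinearMap.prod LinearMap.id (z • LinearMap.id))

end Spectrum

/-! ### Spinors -/

/-- The structure of a spinor module `Σ_n` on the finite-dimensional Hilbert space `S`: a complex
representation of the Clifford algebra of `ℝⁿ`, given by the Clifford multiplications `γ i` with
the standard basis vectors `E_i` of `ℝⁿ`, of dimension `2 ^ ⌊n/2⌋` and such that
Clifford multiplication with vectors is skew-Hermitian. -/
structure SpinorModule (n : ℕ) (S : Type*) [NormedAddCommGroup S] [InnerProductSpace ℂ S] where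
  /-- Clifford multiplication with the standard basis vectors. -/
  γ : Fin n → S →ₗ[ℂ] S
  clifford : ∀ i j x, γ i (γ j x) + γ j (γ i x) = if i = j then (-2 : ℂ) • x else 0
  skew : ∀ i x y, inner ℂ (γ i x) y = - inner ℂ x (γ i y)
  finrank_eq : Module.finrank ℂ S = 2 ^ (n / 2)

section SpinorModuleExistence

variable {S : Type*} [NormedAddCommGroup S] [InnerProductSpace ℂ S]

theorem prod_ext {p q : WithLp 2 (S × S)} (h1 : p.fst = q.fst) (h2 : p.snd = q.snd) : p = q :=
  WithLp.ofLp_injective 2 (Prod.ext h1 h2)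

/-- The linear endomorphism of `S ⊕ S` given by `(x, y) ↦ (a x + b y, c x + d y)`. -/
def blockMap (a b c d : S →ₗ[ℂ] S) : WithLp 2 (S × S) →ₗ[ℂ] WithLp 2 (S × S) where
  toFun p := WithLp.toLp 2 (a p.fst + b p.snd, c p.fst + d p.snd)
  map_add' p q := by
    apply prod_ext <;> simp <;> abel
  map_smul' z p := by
    apply prod_ext <;> simp

/-- Clifford multiplications of `ℝⁿ⁺²` on `S ⊕ S`, for a spinor module `S` of `ℝⁿ`. -/
def SpinorModule.doubleγ {n : ℕ} (σ : SpinorModule n S) :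
    Fin (n + 2) → WithLp 2 (S × S) →ₗ[ℂ] WithLp 2 (S × S) :=
  Fin.snoc (α := fun _ => WithLp 2 (S × S) →ₗ[ℂ] WithLp 2 (S × S))
    (Fin.snoc (α := fun _ => WithLp 2 (S × S) →ₗ[ℂ] WithLp 2 (S × S))
      (fun i => blockMap (σ.γ i) 0 0 (-σ.γ i))
      (blockMap 0 (Complex.I • LinearMap.id) (Complex.I • LinearMap.id) 0))
    (blockMap 0 (-LinearMap.id) LinearMap.id 0)

/-- The spinor module of `ℝⁿ⁺²` on `S ⊕ S`, for a spinor module `S` of `ℝⁿ`. -/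
def SpinorModule.double {n : ℕ} (σ : SpinorModule n S) :
    SpinorModule (n + 2) (WithLp 2 (S × S)) where
  γ := σ.doubleγ
  clifford i j p := by
    have hI : ∀ x : S, Complex.I • Complex.I • x = -x := fun x => by
      rw [smul_smul, Complex.I_mul_I, neg_one_smul]
    have hne : ∀ k : Fin (n + 1), ¬ (Fin.last (n + 1) = k.castSucc) :=
      fun k h => (Fin.castSucc_lt_last k).ne h.symm
    have hne' : ∀ k : Fin n, ¬ (Fin.last n = k.castSucc) :=
      fun k h => (Fin.castSucc_lt_last k).ne h.symm
    have hc := σ.clifford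
    induction i using Fin.lastCases with
    | last =>
      induction j using Fin.lastCases with
      | last => apply prod_ext <;> simp [doubleγ, blockMap] <;> module
      | cast j =>
        induction j using Fin.lastCases with
        | last => apply prod_ext <;> simp [doubleγ, blockMap, hne]
        | cast j => apply prod_ext <;> simp [doubleγ, blockMap, hne]
    | cast i =>
      induction i using Fin.lastCases with
      | last =>
        induction j using Fin.lastCases with
        | last => apply prod_ext <;> simp [doubleγ, blockMap]
        | cast j =>
          induction j using Fin.lastCases with
          | last => apply prod_ext <;> simp [doubleγ, blockMap, hI] <;> module
          | cast j => apply prod_ext <;> simp [doubleγ, blockMap, hne']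
      | cast i =>
        induction j using Fin.lastCases with
        | last => apply prod_ext <;> simp [doubleγ, blockMap]
        | cast j =>
          induction j using Fin.lastCases with
          | last => apply prod_ext <;> simp [doubleγ, blockMap]
          | cast j =>
            by_cases h : i = j
            · subst h
              apply prod_ext
              · simpa [doubleγ, blockMap] using hc i i p.fst
              · simpa [doubleγ, blockMap] using hc i i p.snd
            · apply prod_ext
              · simpa [doubleγ, blockMap, h] using hc i j p.fst
              · simpa [doubleγ, blockMap, h] using hc i j p.snd
  skew i p q := by
    have hs := σ.skew
    induction i using Fin.lastCases with
    | last => simp [doubleγ, blockMap, WithLp.prod_inner_apply]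
    | cast i =>
      induction i using Fin.lastCases with
      | last =>
        simp [doubleγ, blockMap, WithLp.prod_inner_apply, inner_smul_left, inner_smul_right]
      | cast i =>
        simp [doubleγ, blockMap, WithLp.prod_inner_apply, hs, add_comm]
  finrank_eq := by
    have h0 : Module.finrank ℂ S = 2 ^ (n / 2) := σ.finrank_eq
    have : FiniteDimensional ℂ S := Module.finite_of_finrank_pos (by rw [h0]; positivity)
    rw [(WithLp.linearEquiv 2 ℂ (S × S)).finrank_eq, Module.finrank_prod, h0]
    have : (n + 2) / 2 = n / 2 + 1 := by omega
    rw [this, pow_succ]; ring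
end SpinorModuleExistence

/-- Spinor modules exist in every dimension. -/
theorem exists_spinorModule (n : ℕ) :
    ∃ (S : Type) (_ : NormedAddCommGroup S) (_ : InnerProductSpace ℂ S),
      Nonempty (SpinorModule n S) := by
  induction n using Nat.twoStepInduction with
  | zero => exact ⟨ℂ, inferInstance, inferInstance,
      ⟨⟨fun i => i.elim0, fun i => i.elim0, fun i => i.elim0, by simp⟩⟩⟩
  | one => exact ⟨ℂ, inferInstance, inferInstance,
      ⟨⟨fun _ => Complex.I • LinearMap.id, fun i j x => by
        rw [if_pos (Subsingleton.elim i j)]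
        simp only [LinearMap.smul_apply, LinearMap.id_apply, smul_eq_mul, ← mul_assoc,
          Complex.I_mul_I]
        ring, fun i x y => by simp; ring, by simp⟩⟩⟩
  | more n ih _ =>
    obtain ⟨S, _, _, ⟨σ⟩⟩ := ih
    exact ⟨WithLp 2 (S × S), inferInstance, inferInstance, ⟨σ.double⟩⟩

/-! ### The Dirac operator -/

section Dirac

variable {E : Type*} [NormedAddCommGroup E] [NormedSpace ℝ E]
  {G : Type*} [Group G] [TopologicalSpace G] [ChartedSpace E G] [LieGroup 𝓘(ℝ, E) ∞ G]

/-- A Riemannian metric on `G` is left-invariant if all left translations are isometries. -/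
def IsLeftInvariantMetric
    (m : Bundle.ContMDiffRiemannianMetric 𝓘(ℝ, E) ∞ E
      (fun x : G => TangentSpace 𝓘(ℝ, E) x)) : Prop :=
  ∀ (a x : G) (v w : TangentSpace 𝓘(ℝ, E) x),
    m.inner (a * x) (mfderiv 𝓘(ℝ, E) 𝓘(ℝ, E) (fun y => a * y) x v)
      (mfderiv 𝓘(ℝ, E) 𝓘(ℝ, E) (fun y => a * y) x w) = m.inner x v w

variable (m : Bundle.ContMDiffRiemannianMetric 𝓘(ℝ, E) ∞ E
      (fun x : G => TangentSpace 𝓘(ℝ, E) x)) {n : ℕ}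
  (e : Module.Basis (Fin n) ℝ (GroupLieAlgebra 𝓘(ℝ, E) G))

/-- The basis `e` of the Lie algebra `T_1 G` is orthonormal for the metric `m`. -/
def IsOrthonormalFrame : Prop := ∀ i j, m.inner 1 (e i) (e j) = if i = j then 1 else 0

/-- The Christoffel symbols `Γ^k_ij = ⟨∇_{e_i} e_j, e_k⟩` of the Levi-Civita connection of a
left-invariant metric with respect to an orthonormal frame of left-invariant vector fields. For
left-invariant fields the Koszul formula reads
`2 ⟨∇_X Y, Z⟩ = ⟨[X, Y], Z⟩ - ⟨[Y, Z], X⟩ + ⟨[Z, X], Y⟩`. -/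
def christoffel (i j k : Fin n) : ℝ :=
  (m.inner 1 ⁅e i, e j⁆ (e k) - m.inner 1 ⁅e j, e k⁆ (e i) + m.inner 1 ⁅e k, e i⁆ (e j)) / 2

variable {S : Type*} [NormedAddCommGroup S] [InnerProductSpace ℂ S]

/-- The derivative `∂_X s` of `s : G → S` along the left-invariant vector field `X`. -/
def leftInvariantDeriv (X : GroupLieAlgebra 𝓘(ℝ, E) G) (s : G → S) (g : G) : S :=
  mfderiv 𝓘(ℝ, E) 𝓘(ℝ, S) s g (mulInvariantVectorField X g)

/-- The spinor connection
`∇_{e_i} s = ∂_{e_i} s + 1/4 ∑_{j,k} Γ^k_ij γ(E_j) γ(E_k) s` for spinors `s : G → Σ_n`. -/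
def spinorConnection (σ : SpinorModule n S) (i : Fin n) (s : G → S) (g : G) : S :=
  leftInvariantDeriv (e i) s g +
    (1 / 4 : ℂ) • ∑ j, ∑ k, (christoffel m e i j k : ℂ) • σ.γ j (σ.γ k (s g))

/-- The Dirac operator `D s = ∑_i γ(E_i) ∇_{e_i} s` on spinors `s : G → Σ_n`. -/
def diracOnG (σ : SpinorModule n S) (s : G → S) (g : G) : S :=
  ∑ i, σ.γ i (spinorConnection m e σ i s g)

theorem leftInvariantDeriv_add (X : GroupLieAlgebra 𝓘(ℝ, E) G) {s t : G → S}
    (hs : ContMDiff 𝓘(ℝ, E) 𝓘(ℝ, S) ∞ s) (ht : ContMDiff 𝓘(ℝ, E) 𝓘(ℝ, S) ∞ t) (g : G) :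
    leftInvariantDeriv X (s + t) g = leftInvariantDeriv X s g + leftInvariantDeriv X t g := by
  unfold leftInvariantDeriv
  rw [mfderiv_add (hs.mdifferentiable (by simp) g) (ht.mdifferentiable (by simp) g)]
  rfl

theorem leftInvariantDeriv_smul (X : GroupLieAlgebra 𝓘(ℝ, E) G) (c : ℂ) {s : G → S}
    (hs : ContMDiff 𝓘(ℝ, E) 𝓘(ℝ, S) ∞ s) (g : G) :
    leftInvariantDeriv X (c • s) g = c • leftInvariantDeriv X s g := by
  unfold leftInvariantDeriv
  let L : S →L[ℝ] S := (c • ContinuousLinearMap.id ℂ S).restrictScalars ℝ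
  have h1 : (c • s : G → S) = L ∘ s := by ext; simp [L]
  have h2 := mfderiv_comp (I := 𝓘(ℝ, E)) (I' := 𝓘(ℝ, S)) (I'' := 𝓘(ℝ, S)) g
    (L.contMDiff (n := 1)|>.mdifferentiable (by simp) (s g)) (hs.mdifferentiable (by simp) g)
  rw [h1, h2, ContinuousLinearMap.mfderiv_eq]
  rfl

variable {m e}

theorem diracOnG_add (σ : SpinorModule n S) {s t : G → S}
    (hs : ContMDiff 𝓘(ℝ, E) 𝓘(ℝ, S) ∞ s) (ht : ContMDiff 𝓘(ℝ, E) 𝓘(ℝ, S) ∞ t) (g : G) :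
    diracOnG m e σ (s + t) g = diracOnG m e σ s g + diracOnG m e σ t g := by
  simp only [diracOnG, spinorConnection, leftInvariantDeriv_add _ hs ht, Pi.add_apply, map_add,
    smul_add, Finset.sum_add_distrib]
  abel

theorem diracOnG_smul (σ : SpinorModule n S) (c : ℂ) {s : G → S}
    (hs : ContMDiff 𝓘(ℝ, E) 𝓘(ℝ, S) ∞ s) (g : G) :
    diracOnG m e σ (c • s) g = c • diracOnG m e σ s g := by
  simp only [diracOnG, spinorConnection, leftInvariantDeriv_smul _ c hs, Pi.smul_apply, map_smul,
    smul_add, map_add, Finset.smul_sum, map_sum]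
  refine Finset.sum_congr rfl fun i _ => congrArg _ (Finset.sum_congr rfl fun j _ =>
    Finset.sum_congr rfl fun k _ => ?_)
  rw [smul_comm c, smul_comm c]

theorem diracOnG_zero (σ : SpinorModule n S) (g : G) :
    diracOnG m e σ (0 : G → S) g = 0 := by
  have h := diracOnG_smul (m := m) (e := e) σ 0 (s := (0 : G → S)) contMDiff_const g
  simpa using h

variable (m e)

variable [IsTopologicalGroup G] [T2Space G] [LocallyCompactSpace G] [SecondCountableTopology G]
  [MeasurableSpace G] [BorelSpace G]

/-- The graph of the Dirac operator of `Γ \ G` with the spin structure `ε` on smooth spinors: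
smooth `ε`-equivariant maps `s : G → Σ_n` are sent to `D s`. -/
def smoothDiracGraph (μ : Measure G) [μ.IsHaarMeasure] (Γ : Subgroup G) (ε : Γ →* ℤˣ)
    (σ : SpinorModule n S) : Submodule ℂ (EquivL2 μ Γ ε S × EquivL2 μ Γ ε S) where
  carrier := {p | ∃ s : G → S, ContMDiff 𝓘(ℝ, E) 𝓘(ℝ, S) ∞ s ∧
    (p.1 : G →ₘ[μ] S) =ᵐ[μ] s ∧ (p.2 : G →ₘ[μ] S) =ᵐ[μ] diracOnG m e σ s}
  zero_mem' := by
    refine ⟨0, contMDiff_const, AEEqFun.coeFn_zero, ?_⟩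
    exact AEEqFun.coeFn_zero.trans
      (Filter.Eventually.of_forall fun g => (diracOnG_zero σ g).symm)
  add_mem' := by
    rintro p q ⟨s, hs, hs1, hs2⟩ ⟨t, ht, ht1, ht2⟩
    refine ⟨s + t, hs.add ht, ?_, ?_⟩
    · exact (AEEqFun.coeFn_add _ _).trans (hs1.add ht1)
    · refine ((AEEqFun.coeFn_add _ _).trans (hs2.add ht2)).trans ?_
      exact Filter.Eventually.of_forall fun g => (diracOnG_add σ hs ht g).symm
  smul_mem' := by
    rintro c p ⟨s, hs, hs1, hs2⟩
    refine ⟨c • s, ?_, ?_, ?_⟩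
    · exact ((c • ContinuousLinearMap.id ℂ S).restrictScalars ℝ).contMDiff.comp hs
    · exact (AEEqFun.coeFn_smul _ _).trans (hs1.const_smul c)
    · refine ((AEEqFun.coeFn_smul _ _).trans (hs2.const_smul c)).trans ?_
      exact Filter.Eventually.of_forall fun g => (diracOnG_smul σ c hs g).symm

/-- The Dirac operator of `Γ \ G` with the spin structure `ε`, as a closed operator in
`L²(Σ_ε (Γ \ G))`: the closure of the Dirac operator on smooth spinors (its unique self-adjoint
extension), represented by its graph, which is the closure of the graph on smooth spinors. -/
def diracOperator (μ : Measure G) [μ.IsHaarMeasure] (Γ : Subgroup G) [DiscreteTopology Γ]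
    [CompactSpace (Quotient (QuotientGroup.rightRel Γ))] (ε : Γ →* ℤˣ)
    (σ : SpinorModule n S) : Submodule ℂ (EquivL2 μ Γ ε S × EquivL2 μ Γ ε S) :=
  (smoothDiracGraph m e μ Γ ε σ).topologicalClosure

end Dirac

end DiracNil

end

/-! In the left-invariant frame the Dirac operator has constant coefficients: it is a sum of
Clifford multiplications applied to the derivatives along the `e i`, plus a constant endomorphism of
`S` (`diracOnG_eq`). These derivatives are the infinitesimal right translations, so `D` is built
from the right regular representation and from pointwise linear maps of `S`. If `θ` intertwines the
scalar representations, then `θ ⊗ id_S` intertwines the `S`-valued ones and commutes with pointwise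
linear maps, hence it should carry one Dirac operator to the other.

The difficulty is that an intertwiner is only a bounded map between spaces of classes and says
nothing about smoothness. Derivatives are therefore replaced by the averages `R(φ) = ∫ φ(g) R(g) dg`
over test functions `φ`. The spinor `R(φ) f` is smooth for every `f` in `L²`, and its derivative
along `X` is `R(Xφ) f`, where `Xφ` is again a test function. Thus `D R(φ)` involves no derivative of
`f`, and intertwiners commute with it (`map_mollifyL2`, `map_diracMollifyL2`). As `φ` concentrates
at `1`, the pairs `(R(φ) s, D R(φ) s)` tend to `(s, D s)` for smooth `s` (`exists_mollifyL2_close`),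
so they determine the closed operator, and `θ ⊗ id_S` maps one closed graph into the other
(`map_mem_diracOperator`). The same applied to `θ⁻¹` gives equality of graphs, and a linear
homeomorphism that matches the graphs preserves spectra and eigenspace dimensions. -/

noncomputable section

namespace DiracNil

/-! ### Integrals depending smoothly on a parameter. -/

section ParametricIntegral

variable {E : Type*} [NormedAddCommGroup E] [NormedSpace ℝ E]
  {EA : Type*} [NormedAddCommGroup EA] [NormedSpace ℝ EA]
  {HA : Type*} [TopologicalSpace HA] {I : ModelWithCorners ℝ EA HA}
  {A : Type*} [TopologicalSpace A] [ChartedSpace HA A] [IsManifold I ∞ A]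
  {V : Type*} [NormedAddCommGroup V] [NormedSpace ℝ V]
  {W : Type*} [NormedAddCommGroup W] [NormedSpace ℝ W]
  {Z : Type*} [NormedAddCommGroup Z] [NormedSpace ℝ Z]

/-- The partial derivative of a smooth function on `U × A`, in the direction of `U`, is smooth. -/
theorem contMDiffOn_fderiv_fst {U : Set E} (hU : IsOpen U) {Ψ : E × A → V}
    (hΨ : ContMDiffOn (𝓘(ℝ, E).prod I) 𝓘(ℝ, V) ∞ Ψ (U ×ˢ univ)) :
    ContMDiffOn (𝓘(ℝ, E).prod I) 𝓘(ℝ, E →L[ℝ] V) ∞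
      (fun p : E × A => fderiv ℝ (fun u => Ψ (u, p.2)) p.1) (U ×ˢ univ) := by
  intro p hp
  apply ContMDiffAt.contMDiffWithinAt
  have h1 : ContMDiffAt ((𝓘(ℝ, E).prod I).prod 𝓘(ℝ, E)) 𝓘(ℝ, V) ∞
      (Function.uncurry fun (q : E × A) (u : E) => Ψ (u, q.2)) (p, p.1) := by
    have h2 : ContMDiffAt (𝓘(ℝ, E).prod I) 𝓘(ℝ, V) ∞ Ψ (p.1, p.2) :=
      hΨ.contMDiffAt ((hU.prod isOpen_univ).mem_nhds hp)
    exact h2.comp (p, p.1) (f := fun q : (E × A) × E => (q.2, q.1.2))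
      (contMDiffAt_snd.prodMk (contMDiffAt_snd.comp _ contMDiffAt_fst))
  have : IsManifold I 1 A := IsManifold.of_le (n := ∞) (by simp)
  have h3 := ContMDiffAt.mfderiv (m := ∞) (fun (q : E × A) (u : E) => Ψ (u, q.2)) Prod.fst h1
    contMDiffAt_fst (by simp)
  -- Source and target of the differentiated map are vector spaces, so the tangent coordinates are
  -- trivial and the smoothness statement `h3` concerns the plain `fderiv`.
  have h4 := inTangentCoordinates_model_space (I := 𝓘(ℝ, E)) (I' := 𝓘(ℝ, V))
    (Prod.fst : E × A → E) (fun q => Ψ (q.1, q.2))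
    (fun q => (mfderiv 𝓘(ℝ, E) 𝓘(ℝ, V) (fun u => Ψ (u, q.2)) q.1 : E →L[ℝ] V)) p
  have h5 : (fun q : E × A => fderiv ℝ (fun u => Ψ (u, q.2)) q.1) =
      fun q => mfderiv 𝓘(ℝ, E) 𝓘(ℝ, V) (fun u => Ψ (u, q.2)) q.1 :=
    funext fun q => mfderiv_eq_fderiv.symm
  rw [h5.trans h4.symm]
  exact h3

theorem hasFDerivAt_fst {U : Set E} (hU : IsOpen U) {Ψ : E × A → V}
    (hΨ : ContMDiffOn (𝓘(ℝ, E).prod I) 𝓘(ℝ, V) ∞ Ψ (U ×ˢ univ)) {u : E} (hu : u ∈ U)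
    (a : A) : HasFDerivAt (fun v => Ψ (v, a)) (fderiv ℝ (fun v => Ψ (v, a)) u) u := by
  apply DifferentiableAt.hasFDerivAt
  have h2 : ContMDiffAt (𝓘(ℝ, E).prod I) 𝓘(ℝ, V) ∞ Ψ (u, a) :=
    hΨ.contMDiffAt ((hU.prod isOpen_univ).mem_nhds ⟨hu, mem_univ _⟩)
  have h3 := h2.comp u (f := fun v : E => (v, a)) (contMDiffAt_id.prodMk contMDiffAt_const)
  exact (contMDiffAt_iff_contDiffAt.1 h3).differentiableAt (by simp)

variable [FiniteDimensional ℝ E] [SecondCountableTopology A] [MeasurableSpace A] [BorelSpace A]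
  [T2Space A] {μ : Measure A} {K : Set A} {f : A → W} (L : V →L[ℝ] W →L[ℝ] Z)

theorem continuous_right_of_continuousOn {X : Type*} [TopologicalSpace X] {U : Set E}
    {Φ : E × A → X} (hΦ : ContinuousOn Φ (U ×ˢ univ)) {u : E} (hu : u ∈ U) :
    Continuous fun a => Φ (u, a) :=
  hΦ.comp_continuous (continuous_const.prodMk continuous_id) fun _ => ⟨hu, mem_univ _⟩

theorem integrableOn_bilinear (hK : IsCompact K) (hf : IntegrableOn f K μ) {g : A → V}
    (hg : Continuous g) : IntegrableOn (fun a => L (g a) (f a)) K μ := by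
  obtain ⟨C, hC⟩ := hK.exists_bound_of_continuousOn hg.continuousOn
  refine Integrable.mono' (hf.norm.const_mul (‖L‖ * C))
    (L.aestronglyMeasurable_comp₂ hg.aestronglyMeasurable hf.1) ?_
  refine (ae_restrict_iff' hK.measurableSet).2 (Filter.Eventually.of_forall fun a ha => ?_)
  refine (L.le_opNorm₂ _ _).trans ?_
  gcongr
  exact hC a ha

/-- Differentiation under the integral sign. -/
theorem hasFDerivAt_integral_bilinear {U : Set E} (hU : IsOpen U) {Ψ : E × A → V}
    (hΨ : ContMDiffOn (𝓘(ℝ, E).prod I) 𝓘(ℝ, V) ∞ Ψ (U ×ˢ univ))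
    (hK : IsCompact K) (hf : IntegrableOn f K μ) {u : E} (hu : u ∈ U) :
    ∃ D : E →L[ℝ] Z, HasFDerivAt (fun v => ∫ a in K, L (Ψ (v, a)) (f a) ∂μ) D u ∧
      ∀ y, D y = ∫ a in K, L (fderiv ℝ (fun v => Ψ (v, a)) u y) (f a) ∂μ := by
  have hD := (contMDiffOn_fderiv_fst hU hΨ).continuousOn
  obtain ⟨r, hr, hrU⟩ := Metric.nhds_basis_closedBall.mem_iff.1 (hU.mem_nhds hu)
  -- A bound for the partial derivative that is uniform in the parameter; `‖L‖ * C * ‖f a‖` is then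
  -- the dominating function.
  obtain ⟨C, hC⟩ := ((isCompact_closedBall u r).prod hK).exists_bound_of_continuousOn
    (hD.mono (prod_mono hrU (subset_univ K)))
  have hmeas : ∀ v ∈ U, AEStronglyMeasurable
      (fun a => (L.flip (f a)).comp (fderiv ℝ (fun v => Ψ (v, a)) v)) (μ.restrict K) :=
    fun v hv => (ContinuousLinearMap.compL ℝ E V Z).aestronglyMeasurable_comp₂
      (L.flip.continuous.comp_aestronglyMeasurable hf.1)
      (continuous_right_of_continuousOn hD hv).aestronglyMeasurable
  have hbd : ∀ a ∈ K, ∀ v ∈ Metric.closedBall u r,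
      ‖(L.flip (f a)).comp (fderiv ℝ (fun v => Ψ (v, a)) v)‖ ≤ ‖L‖ * C * ‖f a‖ := by
    intro a ha v hv
    refine (ContinuousLinearMap.opNorm_comp_le _ _).trans ?_
    have h1 : ‖L.flip (f a)‖ ≤ ‖L‖ * ‖f a‖ := by
      simpa using L.flip.le_opNorm (f a)
    calc _ ≤ (‖L‖ * ‖f a‖) * C := by
          gcongr
          exact hC (v, a) ⟨hv, ha⟩
      _ = _ := by ring
  have hint : Integrable (fun a => ‖L‖ * C * ‖f a‖) (μ.restrict K) := hf.norm.const_mul _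
  have hF' : Integrable (fun a => (L.flip (f a)).comp (fderiv ℝ (fun v => Ψ (v, a)) u))
      (μ.restrict K) :=
    Integrable.mono' hint (hmeas u hu) ((ae_restrict_iff' hK.measurableSet).2
      (Filter.Eventually.of_forall fun a ha => hbd a ha u (Metric.mem_closedBall_self hr.le)))
  refine ⟨_, hasFDerivAt_integral_of_dominated_of_fderiv_le (𝕜 := ℝ)
    (F' := fun v a => (L.flip (f a)).comp (fderiv ℝ (fun v => Ψ (v, a)) v))
    (Metric.closedBall_mem_nhds u hr) ?_ ?_ (hmeas u hu)
    ((ae_restrict_iff' hK.measurableSet).2 (Filter.Eventually.of_forall hbd)) hint ?_, ?_⟩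
  · filter_upwards [hU.mem_nhds hu] with v hv
    exact (integrableOn_bilinear L hK hf (continuous_right_of_continuousOn hΨ.continuousOn hv)).1
  · exact integrableOn_bilinear L hK hf (continuous_right_of_continuousOn hΨ.continuousOn hu)
  · refine Filter.Eventually.of_forall fun a v hv => ?_
    exact (L.flip (f a)).hasFDerivAt.comp v (hasFDerivAt_fst hU hΨ (hrU hv) a)
  · intro y
    rw [ContinuousLinearMap.integral_apply hF']
    rfl

/-- Smoothness of integrals depending smoothly on a parameter. -/
theorem contDiffOn_integral_bilinear {U : Set E} (hU : IsOpen U)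
    (hK : IsCompact K) (hf : IntegrableOn f K μ) {Ψ : E × A → V}
    (hΨ : ContMDiffOn (𝓘(ℝ, E).prod I) 𝓘(ℝ, V) ∞ Ψ (U ×ˢ univ)) :
    ContDiffOn ℝ ∞ (fun v => ∫ a in K, L (Ψ (v, a)) (f a) ∂μ) U := by
  rw [contDiffOn_infty]
  intro n
  -- Each directional derivative of the integral is an integral of the same kind, with `Ψ` replaced
  -- by its partial derivative; since `E` is finite-dimensional, directional derivatives suffice to
  -- test regularity.
  induction n generalizing Ψ with
  | zero =>
    refine contDiffOn_zero.2 fun u hu => ?_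
    obtain ⟨D, hD, -⟩ := hasFDerivAt_integral_bilinear L hU hΨ hK hf hu
    exact hD.continuousAt.continuousWithinAt
  | succ n ih =>
    rw [show ((n + 1 : ℕ) : WithTop ℕ∞) = (n : WithTop ℕ∞) + 1 by norm_cast]
    refine (contDiffOn_succ_iff_fderiv_apply hU.uniqueDiffOn).2 ⟨fun u hu => ?_,
      -- The clause about analytic regularity is vacuous at finite order.
      fun h => absurd h (WithTop.natCast_ne_top n), ?_⟩
    · obtain ⟨D, hD, -⟩ := hasFDerivAt_integral_bilinear L hU hΨ hK hf hu
      exact hD.differentiableAt.differentiableWithinAt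
    · intro y
      refine (ih (Ψ := fun p => fderiv ℝ (fun u => Ψ (u, p.2)) p.1 y) ?_).congr fun u hu => ?_
      · exact (ContinuousLinearMap.apply ℝ V y).contMDiff.comp_contMDiffOn
          (contMDiffOn_fderiv_fst hU hΨ)
      · obtain ⟨D, hD, hDy⟩ := hasFDerivAt_integral_bilinear L hU hΨ hK hf hu
        rw [fderivWithin_of_isOpen hU hu, hD.fderiv, hDy]

end ParametricIntegral

/-! ### Averages of right translates: smoothness and derivatives. -/

section Mollifier

variable {E : Type*} [NormedAddCommGroup E] [NormedSpace ℝ E]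
  {G : Type*} [Group G] [TopologicalSpace G] [ChartedSpace E G] [LieGroup 𝓘(ℝ, E) ∞ G]
  {S : Type*} [NormedAddCommGroup S] [InnerProductSpace ℂ S]

variable (E G) in
/-- The inverse of the preferred chart of a Lie group at the neutral element. -/
def oneChart (u : E) : G := (extChartAt 𝓘(ℝ, E) (1 : G)).symm u

variable (E G) in
/-- The coordinates of the neutral element in the preferred chart. -/
def oneCoord : E := extChartAt 𝓘(ℝ, E) (1 : G) 1

variable (E G) in
/-- The domain of `oneChart`. -/
def oneTarget : Set E := (extChartAt 𝓘(ℝ, E) (1 : G)).target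

theorem isOpen_oneTarget : IsOpen (oneTarget E G) := isOpen_extChartAt_target 1

theorem oneCoord_mem : oneCoord E G ∈ oneTarget E G := mem_extChartAt_target 1

@[simp] theorem oneChart_oneCoord : oneChart E G (oneCoord E G) = 1 := extChartAt_to_inv 1

theorem contMDiffOn_oneChart : ContMDiffOn 𝓘(ℝ, E) 𝓘(ℝ, E) ∞ (oneChart E G) (oneTarget E G) :=
  contMDiffOn_extChartAt_symm 1

/-- The tangent space at `1` is `E` itself, identified through the preferred chart at `1`, so the
manifold derivative there is by definition the derivative in that chart. -/
theorem mfderiv_one_eq_fderiv (F : G → S) (hF : MDifferentiableAt 𝓘(ℝ, E) 𝓘(ℝ, S) F 1)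
    (X : GroupLieAlgebra 𝓘(ℝ, E) G) :
    (mfderiv 𝓘(ℝ, E) 𝓘(ℝ, S) F 1 X : S) =
      fderiv ℝ (fun u => F (oneChart E G u)) (oneCoord E G) X := by
  have h : (mfderiv 𝓘(ℝ, E) 𝓘(ℝ, S) F 1 : E →L[ℝ] S) =
      fderiv ℝ (fun u => F (oneChart E G u)) (oneCoord E G) := by
    refine hF.mfderiv.trans ?_
    simp only [modelWithCornersSelf_coe, range_id, fderivWithin_univ]
    rfl
  exact congrArg (fun D : E →L[ℝ] S => D X) h

/-- Derivatives along left-invariant vector fields in the preferred chart at `1`. -/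
theorem leftInvariantDeriv_eq_fderiv (X : GroupLieAlgebra 𝓘(ℝ, E) G) {s : G → S} {g : G}
    (hs : MDifferentiableAt 𝓘(ℝ, E) 𝓘(ℝ, S) s g) :
    leftInvariantDeriv X s g =
      fderiv ℝ (fun u => s (g * oneChart E G u)) (oneCoord E G) X := by
  have hl : MDifferentiableAt 𝓘(ℝ, E) 𝓘(ℝ, E) (g * ·) (1 : G) :=
    (contMDiff_mul_left (n := ∞)).contMDiffAt.mdifferentiableAt (by simp)
  have hs' : MDifferentiableAt 𝓘(ℝ, E) 𝓘(ℝ, S) s (g * 1) := by rwa [mul_one]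
  have h1 := mfderiv_comp (I := 𝓘(ℝ, E)) (I' := 𝓘(ℝ, E)) (I'' := 𝓘(ℝ, S)) (1 : G) hs' hl
  have h2 := mfderiv_one_eq_fderiv (s ∘ (g * ·)) (hs'.comp (1 : G) hl) X
  rw [h1] at h2
  refine Eq.trans ?_ h2
  -- The derivatives at `g * 1` and at `g` have different types, although both tangent spaces are
  -- `E`; the equality of points is transported by substitution.
  have h3 : ∀ g' : G, g' = g → ∀ v : E, (mfderiv 𝓘(ℝ, E) 𝓘(ℝ, S) s g : E →L[ℝ] S) v =
      (mfderiv 𝓘(ℝ, E) 𝓘(ℝ, S) s g' : E →L[ℝ] S) v := by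
    rintro _ rfl v
    rfl
  exact h3 (g * 1) (mul_one g) _

theorem contMDiffAt_one_of_contDiffAt {F : G → S}
    (hF : ContDiffAt ℝ ∞ (fun u => F (oneChart E G u)) (oneCoord E G)) :
    ContMDiffAt 𝓘(ℝ, E) 𝓘(ℝ, S) ∞ F 1 := by
  have h1 := hF.contMDiffAt.comp (1 : G) (contMDiffAt_extChartAt (I := 𝓘(ℝ, E)) (n := ∞))
  refine h1.congr_of_eventuallyEq ?_
  filter_upwards [extChartAt_source_mem_nhds (I := 𝓘(ℝ, E)) (1 : G)] with x hx
  exact (congrArg F ((extChartAt 𝓘(ℝ, E) (1 : G)).left_inv hx)).symm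

variable (E) in
/-- The derivative of a function on `G` along a right-invariant vector field: the derivative of
`y ↦ φ (y⁻¹ g)` at the neutral element. -/
def translDeriv (X : E) (φ : G → ℝ) (g : G) : ℝ :=
  fderiv ℝ (fun u => φ ((oneChart E G u)⁻¹ * g)) (oneCoord E G) X

theorem contMDiffOn_transl {φ : G → ℝ} (hφ : ContMDiff 𝓘(ℝ, E) 𝓘(ℝ, ℝ) ∞ φ) :
    ContMDiffOn (𝓘(ℝ, E).prod 𝓘(ℝ, E)) 𝓘(ℝ, ℝ) ∞
      (fun p : E × G => φ ((oneChart E G p.1)⁻¹ * p.2)) (oneTarget E G ×ˢ univ) := by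
  have h1 : ContMDiffOn (𝓘(ℝ, E).prod 𝓘(ℝ, E)) 𝓘(ℝ, E) ∞
      (fun p : E × G => oneChart E G p.1) (oneTarget E G ×ˢ univ) :=
    contMDiffOn_oneChart.comp contMDiffOn_fst fun p hp => hp.1
  exact hφ.comp_contMDiffOn ((h1.inv).mul contMDiffOn_snd)

theorem contMDiff_translDeriv (X : E) {φ : G → ℝ}
    (hφ : ContMDiff 𝓘(ℝ, E) 𝓘(ℝ, ℝ) ∞ φ) :
    ContMDiff 𝓘(ℝ, E) 𝓘(ℝ, ℝ) ∞ (translDeriv E X φ) := by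
  have h1 := contMDiffOn_fderiv_fst isOpen_oneTarget (contMDiffOn_transl hφ)
  have h2 : ContMDiff 𝓘(ℝ, E) (𝓘(ℝ, E).prod 𝓘(ℝ, E)) ∞ (fun g : G => (oneCoord E G, g)) :=
    contMDiff_const.prodMk contMDiff_id
  have h3 := h1.comp_contMDiff h2 fun g => ⟨oneCoord_mem, mem_univ _⟩
  exact (ContinuousLinearMap.apply ℝ ℝ X).contMDiff.comp h3

variable [IsTopologicalGroup G]

/-- Off the closed support of `φ`, small left translations of the argument do not reach the support,
so the derivative vanishes there. Together with `contMDiff_translDeriv` this makes the derivative a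
test function again. -/
theorem hasCompactSupport_translDeriv (X : E) {φ : G → ℝ}
    (hφ : HasCompactSupport φ) : HasCompactSupport (translDeriv E X φ) := by
  refine hφ.mono' fun g hg => ?_
  by_contra h
  apply hg
  have h1 : ContinuousAt (fun u : E => (oneChart E G u)⁻¹ * g) (oneCoord E G) :=
    ((contMDiffOn_oneChart.continuousOn.continuousAt
      (isOpen_oneTarget.mem_nhds oneCoord_mem)).inv).mul continuousAt_const
  have h2 : ∀ᶠ u in 𝓝 (oneCoord E G), φ ((oneChart E G u)⁻¹ * g) = 0 := by
    have h3 := h1.eventually_mem ((isClosed_tsupport φ).isOpen_compl.mem_nhds (by simpa using h))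
    filter_upwards [h3] with u hu
    exact image_eq_zero_of_notMem_tsupport hu
  have h4 : (fun u : E => φ ((oneChart E G u)⁻¹ * g)) =ᶠ[𝓝 (oneCoord E G)] fun _ => 0 := h2
  rw [translDeriv, h4.fderiv_eq]
  simp

variable [T2Space G] [LocallyCompactSpace G] [SecondCountableTopology G]
  [MeasurableSpace G] [BorelSpace G] (μ : Measure G)

/-- The average `∫ φ(g) f(x g) dg = ∫ φ(x⁻¹ g) f(g) dg` of the right translates of `f`. -/
def mollify (φ : G → ℝ) (f : G → S) (x : G) : S := ∫ g, φ (x⁻¹ * g) • f g ∂μ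

variable [μ.IsHaarMeasure]

/-- Left invariance of `μ`. It reduces statements about `mollify` at a point `x` to the neutral
element, with `f` replaced by a left translate. -/
theorem mollify_mul_left (φ : G → ℝ) (f : G → S) (x y : G) :
    mollify μ φ f (x * y) = mollify μ φ (fun g => f (x * g)) y := by
  unfold mollify
  rw [← integral_mul_left_eq_self _ x]
  simp [mul_assoc]

/-- In the definition of `mollify` the point `x` enters only the smooth factor `φ`, which gives
regularity; in this form it enters only `f`, which exhibits the operator `∫ φ(g) R(g) dg`. -/
theorem mollify_eq_integral_mul (φ : G → ℝ) (f : G → S) (x : G) :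
    mollify μ φ f x = ∫ g, φ g • f (x * g) ∂μ := by
  have h := mollify_mul_left μ φ f x 1
  rw [mul_one] at h
  rw [h]
  simp [mollify]

theorem locallyIntegrable_mul_left {f : G → S} (hf : LocallyIntegrable f μ) (x : G) :
    LocallyIntegrable (fun g => f (x * g)) μ := by
  rw [locallyIntegrable_iff] at hf ⊢
  intro K hK
  have h1 := (measurePreserving_mul_left μ x).integrableOn_comp_preimage
    (Homeomorph.mulLeft x).measurableEmbedding (f := f) (s := (x * ·) '' K)
  have h2 := h1.2 (hf _ (hK.image (continuous_const_mul x)))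
  rwa [preimage_image_eq _ (mul_right_injective x)] at h2

variable [FiniteDimensional ℝ E]

/-- Auxiliary description of `mollify φ f` near the neutral element. -/
theorem mollify_oneChart {φ : G → ℝ} (hφ : ContMDiff 𝓘(ℝ, E) 𝓘(ℝ, ℝ) ∞ φ)
    (hφc : HasCompactSupport φ) {f : G → S} (hf : LocallyIntegrable f μ) :
    ContDiffAt ℝ ∞ (fun u => mollify μ φ f (oneChart E G u)) (oneCoord E G) ∧
      ∀ X : E, fderiv ℝ (fun u => mollify μ φ f (oneChart E G u)) (oneCoord E G) X =
        ∫ g, translDeriv E X φ g • f g ∂μ := by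
  obtain ⟨r, hr, hrU⟩ := Metric.nhds_basis_closedBall.mem_iff.1
    (isOpen_oneTarget.mem_nhds (oneCoord_mem (E := E) (G := G)))
  let U : Set E := Metric.ball (oneCoord E G) r
  have hU0 : oneCoord E G ∈ U := Metric.mem_ball_self hr
  have hUT : U ⊆ oneTarget E G := Metric.ball_subset_closedBall.trans hrU
  -- `K` contains the supports of all translates of `φ` by points of the coordinate ball, so near
  -- `1` the average is an integral over one fixed compact set.
  let K : Set G := oneChart E G '' Metric.closedBall (oneCoord E G) r * tsupport φ
  have hK : IsCompact K :=
    ((isCompact_closedBall _ _).image_of_continuousOn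
      (contMDiffOn_oneChart.continuousOn.mono hrU)).mul hφc
  have hzero : ∀ u ∈ U, ∀ g ∉ K, φ ((oneChart E G u)⁻¹ * g) = 0 := by
    intro u hu g hg
    apply image_eq_zero_of_notMem_tsupport
    intro h
    apply hg
    refine ⟨oneChart E G u, mem_image_of_mem _ (Metric.ball_subset_closedBall hu), _, h, ?_⟩
    simp
  have hzero' : ∀ g ∉ K, ∀ X : E, translDeriv E X φ g = 0 := by
    intro g hg X
    have h4 : (fun u : E => φ ((oneChart E G u)⁻¹ * g)) =ᶠ[𝓝 (oneCoord E G)] fun _ => 0 := by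
      filter_upwards [Metric.isOpen_ball.mem_nhds hU0] with u hu
      exact hzero u hu g hg
    rw [translDeriv, h4.fderiv_eq]
    simp
  have hΨ := (contMDiffOn_transl hφ).mono (prod_mono hUT (subset_univ (univ : Set G)))
  have hfK : IntegrableOn f K μ := hf.integrableOn_isCompact hK
  let L : ℝ →L[ℝ] S →L[ℝ] S := ContinuousLinearMap.lsmul ℝ ℝ
  have heq : ∀ u ∈ U, mollify μ φ f (oneChart E G u) =
      ∫ g in K, L (φ ((oneChart E G u)⁻¹ * g)) (f g) ∂μ := by
    intro u hu
    refine (setIntegral_eq_integral_of_forall_compl_eq_zero fun g hg => ?_).symm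
    simp [hzero u hu g hg]
  have heq' : (fun u => mollify μ φ f (oneChart E G u)) =ᶠ[𝓝 (oneCoord E G)]
      fun u => ∫ g in K, L (φ ((oneChart E G u)⁻¹ * g)) (f g) ∂μ := by
    filter_upwards [Metric.isOpen_ball.mem_nhds hU0] with u hu using heq u hu
  refine ⟨?_, fun X => ?_⟩
  · exact ((contDiffOn_integral_bilinear L Metric.isOpen_ball hK hfK hΨ).contDiffAt
      (Metric.isOpen_ball.mem_nhds hU0)).congr_of_eventuallyEq heq'
  · obtain ⟨D, hD, hDy⟩ := hasFDerivAt_integral_bilinear L Metric.isOpen_ball hΨ hK hfK hU0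
    rw [heq'.fderiv_eq, hD.fderiv, hDy X]
    refine setIntegral_eq_integral_of_forall_compl_eq_zero fun g hg => ?_
    have := hzero' g hg X
    rw [translDeriv] at this
    simp [this]

/-- Averages of locally integrable functions against test functions are smooth. -/
theorem contMDiff_mollify {φ : G → ℝ} (hφ : ContMDiff 𝓘(ℝ, E) 𝓘(ℝ, ℝ) ∞ φ)
    (hφc : HasCompactSupport φ) {f : G → S} (hf : LocallyIntegrable f μ) :
    ContMDiff 𝓘(ℝ, E) 𝓘(ℝ, S) ∞ (mollify μ φ f) := by
  intro x
  have h1 := contMDiffAt_one_of_contDiffAt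
    (mollify_oneChart μ hφ hφc (locallyIntegrable_mul_left μ hf x)).1
  have h2 : mollify μ φ f = mollify μ φ (fun g => f (x * g)) ∘ (x⁻¹ * ·) := by
    ext y
    rw [Function.comp, ← mollify_mul_left, mul_inv_cancel_left]
  rw [h2]
  refine ContMDiffAt.comp x ?_ contMDiff_mul_left.contMDiffAt
  rwa [inv_mul_cancel]

/-- A left-invariant derivative of an average falls on the test function. -/
theorem leftInvariantDeriv_mollify (X : GroupLieAlgebra 𝓘(ℝ, E) G) {φ : G → ℝ}
    (hφ : ContMDiff 𝓘(ℝ, E) 𝓘(ℝ, ℝ) ∞ φ)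
    (hφc : HasCompactSupport φ) {f : G → S} (hf : LocallyIntegrable f μ) (x : G) :
    leftInvariantDeriv X (mollify μ φ f) x = mollify μ (translDeriv E X φ) f x := by
  rw [leftInvariantDeriv_eq_fderiv X
    ((contMDiff_mollify μ hφ hφc hf).mdifferentiable (by simp) x)]
  simp only [mollify_mul_left]
  rw [(mollify_oneChart μ hφ hφc (locallyIntegrable_mul_left μ hf x)).2 X,
    mollify_eq_integral_mul]

variable (E) in
/-- The derivative `∂_X (s(· g)) (x)` of a right translate of `s`. -/
def translateDeriv (X : E) (s : G → S) (x g : G) : S :=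
  fderiv ℝ (fun u => s (x * oneChart E G u * g)) (oneCoord E G) X

theorem contMDiffOn_mul_oneChart_mul {s : G → S} (hs : ContMDiff 𝓘(ℝ, E) 𝓘(ℝ, S) ∞ s) :
    ContMDiffOn (𝓘(ℝ, E).prod (𝓘(ℝ, E).prod 𝓘(ℝ, E))) 𝓘(ℝ, S) ∞
      (fun p : E × (G × G) => s (p.2.1 * oneChart E G p.1 * p.2.2)) (oneTarget E G ×ˢ univ) := by
  have h1 : ContMDiffOn (𝓘(ℝ, E).prod (𝓘(ℝ, E).prod 𝓘(ℝ, E))) 𝓘(ℝ, E) ∞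
      (fun p : E × (G × G) => oneChart E G p.1) (oneTarget E G ×ˢ univ) :=
    contMDiffOn_oneChart.comp contMDiffOn_fst fun p hp => hp.1
  exact hs.comp_contMDiffOn (((contMDiff_fst.comp contMDiff_snd).contMDiffOn.mul h1).mul
    (contMDiff_snd.comp contMDiff_snd).contMDiffOn)

/-- For smooth `s` the derivative may instead fall on `s`. Here `φ` stays undifferentiated, so this
is the form that survives when `φ` concentrates at `1`. -/
theorem leftInvariantDeriv_mollify_of_contMDiff (X : GroupLieAlgebra 𝓘(ℝ, E) G) {φ : G → ℝ}
    (hφ : ContMDiff 𝓘(ℝ, E) 𝓘(ℝ, ℝ) ∞ φ) (hφc : HasCompactSupport φ) {s : G → S}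
    (hs : ContMDiff 𝓘(ℝ, E) 𝓘(ℝ, S) ∞ s) (x : G) :
    leftInvariantDeriv X (mollify μ φ s) x = ∫ g, φ g • translateDeriv E X s x g ∂μ := by
  have hsl : LocallyIntegrable s μ := hs.continuous.locallyIntegrable
  rw [leftInvariantDeriv_eq_fderiv X
    ((contMDiff_mollify μ hφ hφc hsl).mdifferentiable (by simp) x)]
  -- The roles are exchanged: `s` is now the smooth kernel and `φ` the integrable weight.
  let L : S →L[ℝ] ℝ →L[ℝ] S := (ContinuousLinearMap.lsmul ℝ ℝ).flip
  have hK : IsCompact (tsupport φ) := hφc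
  have hφK : IntegrableOn φ (tsupport φ) μ := hφ.continuous.continuousOn.integrableOn_compact hK
  have heq : (fun u => mollify μ φ s (x * oneChart E G u)) =
      fun u => ∫ g in tsupport φ, L (s (x * oneChart E G u * g)) (φ g) ∂μ := by
    ext u
    rw [mollify_eq_integral_mul]
    refine (setIntegral_eq_integral_of_forall_compl_eq_zero fun g hg => ?_).symm
    simp [image_eq_zero_of_notMem_tsupport hg]
  have h1 : ContMDiff (𝓘(ℝ, E).prod 𝓘(ℝ, E)) (𝓘(ℝ, E).prod (𝓘(ℝ, E).prod 𝓘(ℝ, E))) ∞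
      (fun p : E × G => (p.1, (x, p.2))) :=
    contMDiff_fst.prodMk (contMDiff_const.prodMk contMDiff_snd)
  have hΨ := (contMDiffOn_mul_oneChart_mul hs).comp (t := oneTarget E G ×ˢ univ) h1.contMDiffOn
    (s := oneTarget E G ×ˢ univ) fun p hp => ⟨hp.1, mem_univ _⟩
  obtain ⟨D, hD, hDy⟩ := hasFDerivAt_integral_bilinear L isOpen_oneTarget hΨ hK hφK oneCoord_mem
  have hD' : HasFDerivAt (fun u => ∫ g in tsupport φ, L (s (x * oneChart E G u * g)) (φ g) ∂μ) D
    (oneCoord E G) := hD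
  rw [heq, hD'.fderiv]
  refine (hDy X).trans ?_
  refine setIntegral_eq_integral_of_forall_compl_eq_zero fun g hg => ?_
  simp [L, image_eq_zero_of_notMem_tsupport hg]

theorem continuous_translateDeriv (X : E) {s : G → S}
    (hs : ContMDiff 𝓘(ℝ, E) 𝓘(ℝ, S) ∞ s) :
    Continuous fun p : G × G => translateDeriv E X s p.1 p.2 := by
  have h1 := (contMDiffOn_fderiv_fst isOpen_oneTarget
    (contMDiffOn_mul_oneChart_mul hs)).continuousOn
  exact (ContinuousLinearMap.apply ℝ S X).continuous.comp
    (continuous_right_of_continuousOn h1 oneCoord_mem)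

theorem translateDeriv_one (X : GroupLieAlgebra 𝓘(ℝ, E) G) {s : G → S}
    (hs : ContMDiff 𝓘(ℝ, E) 𝓘(ℝ, S) ∞ s) (x : G) :
    translateDeriv E X s x 1 = leftInvariantDeriv X s x := by
  rw [leftInvariantDeriv_eq_fderiv X (hs.mdifferentiable (by simp) x)]
  simp [translateDeriv]

end Mollifier

/-! ### The averaging operators on `L²` and their commutation with intertwiners. -/

section MollifyL2

variable {E : Type*} [NormedAddCommGroup E] [NormedSpace ℝ E] [FiniteDimensional ℝ E]
  {G : Type*} [Group G] [TopologicalSpace G] [ChartedSpace E G] [LieGroup 𝓘(ℝ, E) ∞ G]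
  [IsTopologicalGroup G] [T2Space G] [LocallyCompactSpace G] [SecondCountableTopology G]
  [MeasurableSpace G] [BorelSpace G] {μ : Measure G} [μ.IsHaarMeasure]
  {Γ : Subgroup G} {ε : Γ →* ℤˣ}
  {S : Type*} [NormedAddCommGroup S] [InnerProductSpace ℂ S]
  {φ : G → ℝ}

theorem EquivL2.locallyIntegrable (f : EquivL2 μ Γ ε S) :
    LocallyIntegrable (f : G →ₘ[μ] S) μ := by
  rw [locallyIntegrable_iff]
  intro K hK
  have : IsFiniteMeasure (μ.restrict K) := ⟨by simpa using hK.measure_lt_top⟩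
  exact (f.2.2 K hK).integrable (by norm_num)

theorem memLp_restrict_of_continuous {f : G → S} (hf : Continuous f) {K : Set G}
    (hK : IsCompact K) : MemLp f 2 (μ.restrict K) := by
  have : IsFiniteMeasure (μ.restrict K) := ⟨by simpa using hK.measure_lt_top⟩
  obtain ⟨C, hC⟩ := hK.exists_bound_of_continuousOn hf.continuousOn
  exact MemLp.of_bound hf.aestronglyMeasurable C
    ((ae_restrict_iff' hK.measurableSet).2 (Filter.Eventually.of_forall hC))

theorem mollify_congr_ae {f h : G → S} (H : f =ᵐ[μ] h) (φ : G → ℝ) :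
    mollify μ φ f = mollify μ φ h := by
  ext x
  refine integral_congr_ae ?_
  filter_upwards [H] with g hg
  rw [hg]

theorem mollify_equivariant (φ : G → ℝ) (f : EquivL2 μ Γ ε S) (γ : Γ) (x : G) :
    mollify μ φ (f : G →ₘ[μ] S) (γ * x) = ((ε γ : ℤ) : ℂ) • mollify μ φ (f : G →ₘ[μ] S) x := by
  rw [mollify_mul_left, mollify_congr_ae (f.2.1 γ)]
  unfold mollify
  rw [← integral_smul]
  refine integral_congr_ae (Filter.Eventually.of_forall fun g => ?_)
  exact smul_comm _ _ _

/-- The class of a continuous equivariant function. -/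
def EquivL2.ofContinuous (f : G → S) (hf : Continuous f)
    (hf' : ∀ (γ : Γ) (x : G), f (γ * x) = ((ε γ : ℤ) : ℂ) • f x) : EquivL2 μ Γ ε S :=
  ⟨AEEqFun.mk f hf.aestronglyMeasurable, by
    have h0 := AEEqFun.coeFn_mk f (hf.aestronglyMeasurable (μ := μ))
    refine ⟨fun γ => ?_, fun K hK => ?_⟩
    · filter_upwards [h0, (measurePreserving_mul_left μ (γ : G)).quasiMeasurePreserving.ae h0]
        with g h1 h2
      rw [h1, h2, hf']
    · exact (memLp_restrict_of_continuous hf hK).ae_eq (ae_restrict_of_ae h0.symm)⟩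

/-- The operator `R(φ) = ∫ φ(g) R(g) dg` on `L²_ε(Γ \ G; S)`. -/
def mollifyL2 (hφ : ContMDiff 𝓘(ℝ, E) 𝓘(ℝ, ℝ) ∞ φ) (hφc : HasCompactSupport φ)
    (f : EquivL2 μ Γ ε S) : EquivL2 μ Γ ε S :=
  EquivL2.ofContinuous (mollify μ φ (f : G →ₘ[μ] S))
    (contMDiff_mollify μ hφ hφc f.locallyIntegrable).continuous (mollify_equivariant φ f)

theorem mollifyL2_ae (hφ : ContMDiff 𝓘(ℝ, E) 𝓘(ℝ, ℝ) ∞ φ) (hφc : HasCompactSupport φ)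
    (f : EquivL2 μ Γ ε S) :
    (mollifyL2 hφ hφc f : G →ₘ[μ] S) =ᵐ[μ] mollify μ φ (f : G →ₘ[μ] S) :=
  AEEqFun.coeFn_mk _ _

theorem integrable_smul_mul_left (hφ : Continuous φ) (hφc : HasCompactSupport φ) {f : G → S}
    (hf : LocallyIntegrable f μ) (x : G) : Integrable (fun g => φ g • f (x * g)) μ :=
  (locallyIntegrable_mul_left μ hf x).integrable_smul_left_of_hasCompactSupport hφ hφc

variable [DiscreteTopology Γ] [CompactSpace (Quotient (QuotientGroup.rightRel Γ))]

instance : IsFiniteMeasure (μ.restrict (fundDomain μ Γ)) := by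
  obtain ⟨⟨K, hK, hFK⟩, -⟩ := fundDomain_spec μ Γ
  exact ⟨by simpa using (measure_mono hFK).trans_lt hK.measure_lt_top⟩

/-- The integrability needed for Fubini's theorem in `functional_mollifyL2`. -/
theorem integrable_prod_fundDomain (hφ : Continuous φ) (hφc : HasCompactSupport φ) {f h : G → S}
    (hf : LocallyIntegrable f μ) (hh : Integrable h (μ.restrict (fundDomain μ Γ))) :
    Integrable (fun p : G × G => φ p.2 • inner ℂ (h p.1) (f (p.1 * p.2)))
      ((μ.restrict (fundDomain μ Γ)).prod μ) := by
  obtain ⟨⟨K, hK, hFK⟩, hF⟩ := fundDomain_spec μ Γ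
  -- For `x` in the fundamental domain, `φ (x⁻¹ * y)` vanishes unless `y ∈ C`, so the locally
  -- integrable `f` may be cut off to `C`.
  let C : Set G := K * tsupport φ
  have hC : IsCompact C := hK.mul hφc
  obtain ⟨M, hM⟩ := hφc.exists_bound_of_continuous hφ
  have h1 : Integrable (fun p : G × G => φ (p.1⁻¹ * p.2) • inner ℂ (h p.1) (f p.2))
      ((μ.restrict (fundDomain μ Γ)).prod μ) := by
    have hfC : Integrable (C.indicator f) μ :=
      (integrable_indicator_iff hC.measurableSet).2 (hf.integrableOn_isCompact hC)
    refine Integrable.mono' ((hh.norm.mul_prod hfC.norm).const_mul M) ?_ ?_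
    · have m1 : AEStronglyMeasurable (fun p : G × G => h p.1)
          ((μ.restrict (fundDomain μ Γ)).prod μ) := hh.1.comp_fst
      have m2 : AEStronglyMeasurable (fun p : G × G => f p.2)
          ((μ.restrict (fundDomain μ Γ)).prod μ) := hf.aestronglyMeasurable.comp_snd
      exact (hφ.comp ((continuous_fst.inv).mul continuous_snd)).aestronglyMeasurable.smul
        (m1.inner (𝕜 := ℂ) m2)
    · have h2 : ∀ᵐ p ∂((μ.restrict (fundDomain μ Γ)).prod μ), p.1 ∈ fundDomain μ Γ :=
        Measure.quasiMeasurePreserving_fst.ae (ae_restrict_mem₀ hF.nullMeasurableSet)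
      filter_upwards [h2] with p hp
      by_cases hpC : p.2 ∈ C
      · rw [indicator_of_mem hpC, norm_smul]
        gcongr
        · exact (norm_nonneg _).trans (hM 1)
        · exact hM _
        · exact norm_inner_le_norm _ _
      · have : φ (p.1⁻¹ * p.2) = 0 := by
          apply image_eq_zero_of_notMem_tsupport
          intro h'
          exact hpC ⟨p.1, hFK hp, _, h', by simp⟩
        rw [this, indicator_of_notMem hpC]
        simp
  -- The shear `(x, g) ↦ (x, x * g)` preserves the product measure.
  have h2 := (measurePreserving_prod_mul (μ.restrict (fundDomain μ Γ)) μ).integrable_comp_of_integrable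
    h1
  refine h2.congr (Filter.Eventually.of_forall fun p => ?_)
  simp

variable [CompleteSpace S]

/-- Continuous functionals on `L²_ε(Γ \ G; S)` are given by integration over a fundamental
domain. -/
theorem exists_functional_eq_integral (ℓ : EquivL2 μ Γ ε S →L[ℂ] ℂ) :
    ∃ h : G → S, Integrable h (μ.restrict (fundDomain μ Γ)) ∧ ∀ f : EquivL2 μ Γ ε S,
      ℓ f = ∫ x in fundDomain μ Γ, inner ℂ (h x) ((f : G →ₘ[μ] S) x) ∂μ := by
  let J : EquivL2 μ Γ ε S →ₗᵢ[ℂ] Lp S 2 (μ.restrict (fundDomain μ Γ)) :=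
    ⟨EquivL2.restrictFundDomain μ Γ ε S, fun _ => rfl⟩
  -- `J` is isometric by the definition of the norm. Extending the functional from its range by
  -- Hahn–Banach allows the Riesz representation in the full `L²` of the fundamental domain, without
  -- knowing that the range is closed.
  obtain ⟨ℓ', hℓ', -⟩ := exists_extension_norm_eq (LinearMap.range J.toLinearMap)
    (ℓ.comp (J.equivRange.symm.toContinuousLinearEquiv : _ →L[ℂ] EquivL2 μ Γ ε S))
  let h := (InnerProductSpace.toDual ℂ (Lp S 2 (μ.restrict (fundDomain μ Γ)))).symm ℓ'
  refine ⟨h, (Lp.memLp h).integrable (by norm_num), fun f => ?_⟩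
  have h1 : ℓ f = ℓ' (J f) := by
    have h2 := hℓ' (J.equivRange f)
    simpa using h2.symm
  rw [h1, ← InnerProductSpace.toDual_symm_apply, L2.inner_def]
  refine integral_congr_ae ?_
  filter_upwards [MemLp.coeFn_toLp (EquivL2.memLp_fundDomain μ Γ ε S f)] with x hx
  exact congrArg _ hx

/-- The identity `R(φ) = ∫ φ(g) R(g) dg` in the weak sense, by Fubini. The weak form suffices for
`map_mollifyL2`: given an intertwiner `T`, it is applied to both `ℓ` and `ℓ.comp T`. -/
theorem functional_mollifyL2 (hφ : ContMDiff 𝓘(ℝ, E) 𝓘(ℝ, ℝ) ∞ φ) (hφc : HasCompactSupport φ)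
    (ℓ : EquivL2 μ Γ ε S →L[ℂ] ℂ) (f : EquivL2 μ Γ ε S) :
    ℓ (mollifyL2 hφ hφc f) = ∫ g, φ g • ℓ (rightRegular μ Γ ε S g f) ∂μ := by
  obtain ⟨h, hh, hℓ⟩ := exists_functional_eq_integral ℓ
  have hf := f.locallyIntegrable
  have hmol : ∀ x, inner ℂ (h x) (mollify μ φ (f : G →ₘ[μ] S) x) =
      ∫ g, φ g • inner ℂ (h x) ((f : G →ₘ[μ] S) (x * g)) ∂μ := by
    intro x
    rw [mollify_eq_integral_mul,
      ← integral_inner (integrable_smul_mul_left hφ.continuous hφc hf x)]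
    refine integral_congr_ae (Filter.Eventually.of_forall fun g => ?_)
    exact inner_smul_right_eq_smul _ _ _
  calc ℓ (mollifyL2 hφ hφc f)
      = ∫ x in fundDomain μ Γ, ∫ g, φ g • inner ℂ (h x) ((f : G →ₘ[μ] S) (x * g)) ∂μ ∂μ := by
        rw [hℓ]
        refine integral_congr_ae ?_
        filter_upwards [ae_restrict_of_ae (mollifyL2_ae hφ hφc f)] with x hx
        rw [hx, hmol]
    _ = ∫ g, ∫ x in fundDomain μ Γ, φ g • inner ℂ (h x) ((f : G →ₘ[μ] S) (x * g)) ∂μ ∂μ :=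
        integral_integral_swap (integrable_prod_fundDomain hφ.continuous hφc hf hh)
    _ = _ := by
        refine integral_congr_ae (Filter.Eventually.of_forall fun g => ?_)
        beta_reduce
        rw [integral_smul, hℓ]
        congr 1
        refine integral_congr_ae ?_
        filter_upwards [ae_restrict_of_ae (rightTranslate_ae μ Γ ε S g f)] with x hx
        exact congrArg _ hx.symm

/-- Intertwiners of the right regular representations commute with averages of translations. -/
theorem map_mollifyL2 {Γ' : Subgroup G} [DiscreteTopology Γ']
    [CompactSpace (Quotient (QuotientGroup.rightRel Γ'))] {ε' : Γ' →* ℤˣ}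
    (hφ : ContMDiff 𝓘(ℝ, E) 𝓘(ℝ, ℝ) ∞ φ) (hφc : HasCompactSupport φ)
    (T : EquivL2 μ Γ ε S →L[ℂ] EquivL2 μ Γ' ε' S)
    (hT : ∀ g f, T (rightRegular μ Γ ε S g f) = rightRegular μ Γ' ε' S g (T f))
    (f : EquivL2 μ Γ ε S) :
    T (mollifyL2 hφ hφc f) = mollifyL2 hφ hφc (T f) := by
  refine (SeparatingDual.eq_iff_forall_dual_eq (R := ℂ)).2 fun ℓ => ?_
  have h1 := functional_mollifyL2 hφ hφc (ℓ.comp T) f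
  rw [functional_mollifyL2 hφ hφc ℓ (T f)]
  simpa only [ContinuousLinearMap.comp_apply, hT] using h1

end MollifyL2

/-! ### Pointwise linear maps on equivariant functions. -/

section PostComposition

variable {G : Type*} [Group G] [TopologicalSpace G] [IsTopologicalGroup G] [T2Space G]
  [LocallyCompactSpace G] [SecondCountableTopology G] [MeasurableSpace G] [BorelSpace G]
  {μ : Measure G} [μ.IsHaarMeasure] {Γ : Subgroup G} [DiscreteTopology Γ]
  [CompactSpace (Quotient (QuotientGroup.rightRel Γ))] {ε : Γ →* ℤˣ}
  {V : Type*} [NormedAddCommGroup V] [InnerProductSpace ℂ V]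
  {W : Type*} [NormedAddCommGroup W] [InnerProductSpace ℂ W]
  {Z : Type*} [NormedAddCommGroup Z] [InnerProductSpace ℂ Z]

theorem EquivL2.ext_ae {f h : EquivL2 μ Γ ε V}
    (H : (f : G →ₘ[μ] V) =ᵐ[μ] (h : G →ₘ[μ] V)) : f = h :=
  Subtype.ext (AEEqFun.ext H)

theorem EquivL2.norm_le_mul_norm {f : EquivL2 μ Γ ε V} {h : EquivL2 μ Γ ε W} {c : ℝ}
    (H : ∀ᵐ x ∂μ, ‖(f : G →ₘ[μ] V) x‖ ≤ c * ‖(h : G →ₘ[μ] W) x‖) : ‖f‖ ≤ c * ‖h‖ := by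
  refine Lp.norm_le_mul_norm_of_ae_le_mul ?_
  filter_upwards [MemLp.coeFn_toLp (EquivL2.memLp_fundDomain μ Γ ε V f),
    MemLp.coeFn_toLp (EquivL2.memLp_fundDomain μ Γ ε W h), ae_restrict_of_ae H] with x h1 h2 h3
  exact (congrArg norm h1).trans_le (h3.trans_eq (congrArg (fun v => c * ‖v‖) h2.symm))

variable (μ Γ ε V) in
-- The fundamental domain has finite measure, so uniform bounds on it give norm bounds, with a
-- constant independent of the function.
theorem EquivL2.exists_norm_le_of_bound : ∃ M : ℝ, 0 ≤ M ∧ ∀ (f : EquivL2 μ Γ ε V) (c : ℝ), 0 ≤ c →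
    (∀ᵐ x ∂μ, x ∈ fundDomain μ Γ → ‖(f : G →ₘ[μ] V) x‖ ≤ c) → ‖f‖ ≤ M * c := by
  refine ⟨_, by positivity, fun f c hc H => Lp.norm_le_of_ae_bound hc ?_⟩
  have h0 : ∀ᵐ x ∂(μ.restrict (fundDomain μ Γ)), ‖(f : G →ₘ[μ] V) x‖ ≤ c :=
    (ae_restrict_iff'₀ (fundDomain_spec μ Γ).2.nullMeasurableSet).2 H
  filter_upwards [MemLp.coeFn_toLp (EquivL2.memLp_fundDomain μ Γ ε V f), h0] with x h1 h2
  exact (congrArg norm h1).trans_le h2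

/-- Pointwise application of a linear map, as a linear map. -/
def postCompₗ (A : V →L[ℂ] W) : EquivL2 μ Γ ε V →ₗ[ℂ] EquivL2 μ Γ ε W where
  toFun f := ⟨AEEqFun.comp A A.continuous (f : G →ₘ[μ] V), by
    have h0 := AEEqFun.coeFn_comp A A.continuous (f : G →ₘ[μ] V)
    refine ⟨fun γ => ?_, fun K hK => ?_⟩
    · filter_upwards [h0, f.2.1 γ,
        (measurePreserving_mul_left μ (γ : G)).quasiMeasurePreserving.ae h0] with x h1 h2 h3
      rw [h3, h1, Function.comp, Function.comp, h2, map_smul]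
    · exact (A.comp_memLp' (f.2.2 K hK)).ae_eq (ae_restrict_of_ae h0.symm)⟩
  map_add' f h := by
    apply EquivL2.ext_ae
    refine (AEEqFun.coeFn_comp A A.continuous _).trans ?_
    refine Filter.EventuallyEq.trans ?_ (AEEqFun.coeFn_add _ _).symm
    filter_upwards [AEEqFun.coeFn_comp A A.continuous (f : G →ₘ[μ] V),
      AEEqFun.coeFn_comp A A.continuous (h : G →ₘ[μ] V),
      AEEqFun.coeFn_add (f : G →ₘ[μ] V) h] with x h1 h2 h3
    simp only [Function.comp, Pi.add_apply] at *
    rw [h1, h2, ← map_add]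
    exact congrArg A h3
  map_smul' c f := by
    apply EquivL2.ext_ae
    refine (AEEqFun.coeFn_comp A A.continuous _).trans ?_
    refine Filter.EventuallyEq.trans ?_ (AEEqFun.coeFn_smul _ _).symm
    filter_upwards [AEEqFun.coeFn_comp A A.continuous (f : G →ₘ[μ] V),
      AEEqFun.coeFn_smul c (f : G →ₘ[μ] V)] with x h1 h3
    simp only [Function.comp, Pi.smul_apply] at *
    rw [h1, RingHom.id_apply, ← map_smul]
    exact congrArg A h3

theorem postCompₗ_ae (A : V →L[ℂ] W) (f : EquivL2 μ Γ ε V) :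
    (postCompₗ A f : G →ₘ[μ] W) =ᵐ[μ] fun x => A ((f : G →ₘ[μ] V) x) :=
  AEEqFun.coeFn_comp A A.continuous (f : G →ₘ[μ] V)

/-- Pointwise application of a continuous linear map to equivariant functions. -/
def postComp (A : V →L[ℂ] W) : EquivL2 μ Γ ε V →L[ℂ] EquivL2 μ Γ ε W :=
  (postCompₗ A).mkContinuous ‖A‖ fun f => EquivL2.norm_le_mul_norm (by
    filter_upwards [postCompₗ_ae A f] with x hx
    rw [hx]
    exact A.le_opNorm _)

theorem postComp_ae (A : V →L[ℂ] W) (f : EquivL2 μ Γ ε V) :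
    (postComp A f : G →ₘ[μ] W) =ᵐ[μ] fun x => A ((f : G →ₘ[μ] V) x) :=
  postCompₗ_ae A f

theorem postComp_postComp (A : W →L[ℂ] Z) (B : V →L[ℂ] W) (f : EquivL2 μ Γ ε V) :
    postComp A (postComp B f) = postComp (A.comp B) f := by
  apply EquivL2.ext_ae
  filter_upwards [postComp_ae A (postComp B f), postComp_ae B f,
    postComp_ae (A.comp B) f] with x h1 h2 h3
  rw [h1, h2, h3]
  rfl

theorem postComp_id (f : EquivL2 μ Γ ε V) : postComp (ContinuousLinearMap.id ℂ V) f = f :=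
  EquivL2.ext_ae (postComp_ae _ f)

theorem postComp_add (A B : V →L[ℂ] W) (f : EquivL2 μ Γ ε V) :
    postComp (A + B) f = postComp A f + postComp B f := by
  apply EquivL2.ext_ae
  refine Filter.EventuallyEq.trans ?_ (AEEqFun.coeFn_add _ _).symm
  filter_upwards [postComp_ae (A + B) f, postComp_ae A f, postComp_ae B f] with x h1 h2 h3
  rw [h1, Pi.add_apply, h2, h3]
  rfl

theorem postComp_smul (c : ℂ) (A : V →L[ℂ] W) (f : EquivL2 μ Γ ε V) :
    postComp (c • A) f = c • postComp A f := by
  apply EquivL2.ext_ae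
  refine Filter.EventuallyEq.trans ?_ (AEEqFun.coeFn_smul _ _).symm
  filter_upwards [postComp_ae (c • A) f, postComp_ae A f] with x h1 h2
  rw [h1, Pi.smul_apply, h2]
  rfl

theorem postComp_zero (f : EquivL2 μ Γ ε V) : postComp (0 : V →L[ℂ] W) f = 0 := by
  simpa using postComp_smul 0 (0 : V →L[ℂ] W) f

theorem postComp_sum {ι : Type*} (s : Finset ι) (A : ι → V →L[ℂ] W) (f : EquivL2 μ Γ ε V) :
    postComp (∑ i ∈ s, A i) f = ∑ i ∈ s, postComp (A i) f := by
  classical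
  induction s using Finset.induction_on with
  | empty => simpa using postComp_zero f
  | insert i s hi ih => rw [Finset.sum_insert hi, Finset.sum_insert hi, postComp_add, ih]

theorem postComp_rightRegular (A : V →L[ℂ] W) (g : G) (f : EquivL2 μ Γ ε V) :
    postComp A (rightRegular μ Γ ε V g f) = rightRegular μ Γ ε W g (postComp A f) := by
  apply EquivL2.ext_ae
  filter_upwards [postComp_ae A (rightRegular μ Γ ε V g f), rightTranslate_ae μ Γ ε V g f,
    rightTranslate_ae μ Γ ε W g (postComp A f),
    (quasiMeasurePreserving_mul_right μ g).ae (postComp_ae A f)] with x h1 h2 h3 h4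
  rw [h1]
  exact (congrArg A h2).trans (h4.symm.trans h3.symm)

/-! ### Extension of scalar intertwiners to `S`-valued functions. -/

section Extension

variable {Γ' : Subgroup G} [DiscreteTopology Γ']
  [CompactSpace (Quotient (QuotientGroup.rightRel Γ'))] {ε' : Γ' →* ℤˣ}
  {S : Type*} [NormedAddCommGroup S] [InnerProductSpace ℂ S] [FiniteDimensional ℂ S]

theorem sum_coord_smulRight_basis :
    ∑ i, ((Module.finBasis ℂ S).coord i).toContinuousLinearMap.smulRight (Module.finBasis ℂ S i)
      = ContinuousLinearMap.id ℂ S := by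
  ext v
  simp

/-- An `S`-valued class is recovered from its coordinates in a basis; this reduces identities for
`tensorId` to scalar ones. -/
theorem EquivL2.ext_postComp {f h : EquivL2 μ Γ ε S}
    (H : ∀ l : S →L[ℂ] ℂ, postComp l f = postComp l h) : f = h := by
  rw [← postComp_id f, ← postComp_id h, ← sum_coord_smulRight_basis, postComp_sum, postComp_sum]
  refine Finset.sum_congr rfl fun i _ => ?_
  have h1 : ((Module.finBasis ℂ S).coord i).toContinuousLinearMap.smulRight (Module.finBasis ℂ S i)
      = ((ContinuousLinearMap.id ℂ ℂ).smulRight (Module.finBasis ℂ S i)).comp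
        ((Module.finBasis ℂ S).coord i).toContinuousLinearMap := by
    ext v; simp
  rw [h1, ← postComp_postComp, ← postComp_postComp, H]

variable (S) in
/-- The operator `θ ⊗ id_S` on `S`-valued functions. -/
def tensorId (θ : EquivL2 μ Γ ε ℂ →L[ℂ] EquivL2 μ Γ' ε' ℂ) :
    EquivL2 μ Γ ε S →L[ℂ] EquivL2 μ Γ' ε' S :=
  ∑ i, (postComp ((ContinuousLinearMap.id ℂ ℂ).smulRight (Module.finBasis ℂ S i))).comp
    (θ.comp (postComp ((Module.finBasis ℂ S).coord i).toContinuousLinearMap))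

/-- This property characterizes `θ ⊗ id_S` independently of the basis. Combined with
`EquivL2.ext_postComp` it yields the commutation with pointwise maps and translations, and the
behaviour under inverses. -/
theorem postComp_tensorId (θ : EquivL2 μ Γ ε ℂ →L[ℂ] EquivL2 μ Γ' ε' ℂ) (l : S →L[ℂ] ℂ)
    (f : EquivL2 μ Γ ε S) : postComp l (tensorId S θ f) = θ (postComp l f) := by
  have h1 : l = ∑ i, l (Module.finBasis ℂ S i) •
      ((Module.finBasis ℂ S).coord i).toContinuousLinearMap := by
    ext v
    conv_lhs => rw [← (Module.finBasis ℂ S).sum_repr v, map_sum]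
    simp [mul_comm]
  have h2 : ∀ i, l.comp ((ContinuousLinearMap.id ℂ ℂ).smulRight (Module.finBasis ℂ S i)) =
      l (Module.finBasis ℂ S i) • ContinuousLinearMap.id ℂ ℂ := by
    intro i
    ext; simp
  conv_rhs => rw [h1]
  simp only [tensorId, _root_.sum_apply, map_sum, ContinuousLinearMap.comp_apply,
    postComp_postComp, h2, postComp_smul, postComp_id, postComp_sum, map_smul]

theorem tensorId_postComp (θ : EquivL2 μ Γ ε ℂ →L[ℂ] EquivL2 μ Γ' ε' ℂ) (A : S →L[ℂ] S)
    (f : EquivL2 μ Γ ε S) : tensorId S θ (postComp A f) = postComp A (tensorId S θ f) :=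
  EquivL2.ext_postComp fun l => by
    rw [postComp_tensorId, postComp_postComp, postComp_postComp, postComp_tensorId]

theorem tensorId_rightRegular (θ : EquivL2 μ Γ ε ℂ →L[ℂ] EquivL2 μ Γ' ε' ℂ)
    (hθ : ∀ g f, θ (rightRegular μ Γ ε ℂ g f) = rightRegular μ Γ' ε' ℂ g (θ f)) (g : G)
    (f : EquivL2 μ Γ ε S) :
    tensorId S θ (rightRegular μ Γ ε S g f) = rightRegular μ Γ' ε' S g (tensorId S θ f) :=
  EquivL2.ext_postComp fun l => by
    rw [postComp_tensorId, postComp_rightRegular, hθ, postComp_rightRegular, postComp_tensorId]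

theorem tensorId_leftInverse (θ : EquivL2 μ Γ ε ℂ →L[ℂ] EquivL2 μ Γ' ε' ℂ)
    (θ' : EquivL2 μ Γ' ε' ℂ →L[ℂ] EquivL2 μ Γ ε ℂ) (h : Function.LeftInverse θ' θ) :
    Function.LeftInverse (tensorId S θ') (tensorId S θ) := fun f =>
  EquivL2.ext_postComp fun l => by
    rw [postComp_tensorId, postComp_tensorId, h]

end Extension

end PostComposition

/-! ### Invariance of spectra and eigenspaces under conjugation. -/

section GraphTransport

variable {H : Type*} [NormedAddCommGroup H] [NormedSpace ℂ H]
  {H' : Type*} [NormedAddCommGroup H'] [NormedSpace ℂ H']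

/-- The resolvent is conjugated to `Θ R Θ⁻¹`, which is bounded because `Θ` is a homeomorphism; no
isometry is needed. -/
theorem resolventSetOfGraph_subset (Θ : H ≃L[ℂ] H') {T : Submodule ℂ (H × H)}
    {T' : Submodule ℂ (H' × H')} (hT : ∀ f h, (f, h) ∈ T ↔ (Θ f, Θ h) ∈ T') :
    resolventSetOfGraph T ⊆ resolventSetOfGraph T' := by
  rintro z ⟨R, hR⟩
  refine ⟨(Θ : H →L[ℂ] H').comp (R.comp (Θ.symm : H' →L[ℂ] H)), fun f h => ?_⟩
  have h1 := hR (Θ.symm f) (Θ.symm h)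
  rw [hT, Θ.apply_symm_apply, Θ.apply_symm_apply] at h1
  rw [h1, Θ.eq_symm_apply, ← map_smul, ← map_sub]
  rfl

theorem spectrumOfGraph_eq (Θ : H ≃L[ℂ] H') {T : Submodule ℂ (H × H)}
    {T' : Submodule ℂ (H' × H')} (hT : ∀ f h, (f, h) ∈ T ↔ (Θ f, Θ h) ∈ T') :
    spectrumOfGraph T = spectrumOfGraph T' :=
  congrArg compl ((resolventSetOfGraph_subset Θ hT).antisymm
    (resolventSetOfGraph_subset Θ.symm fun f h => by
      rw [hT, Θ.apply_symm_apply, Θ.apply_symm_apply]))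

/-- Conjugate operators have isomorphic eigenspaces. -/
def eigenspaceOfGraphEquiv (Θ : H ≃L[ℂ] H') {T : Submodule ℂ (H × H)}
    {T' : Submodule ℂ (H' × H')} (hT : ∀ f h, (f, h) ∈ T ↔ (Θ f, Θ h) ∈ T') (z : ℂ) :
    eigenspaceOfGraph T z ≃ₗ[ℂ] eigenspaceOfGraph T' z :=
  Θ.toLinearEquiv.ofSubmodules _ _ (by
    ext f
    rw [Submodule.mem_map_equiv]
    change (Θ.symm f, z • Θ.symm f) ∈ T ↔ (f, z • f) ∈ T'
    rw [hT, map_smul, Θ.apply_symm_apply])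

end GraphTransport

/-! ### Test functions concentrated at the neutral element. -/

section ApproximateIdentity

variable {E : Type*} [NormedAddCommGroup E] [NormedSpace ℝ E] [FiniteDimensional ℝ E]
  {G : Type*} [Group G] [TopologicalSpace G] [ChartedSpace E G] [LieGroup 𝓘(ℝ, E) ∞ G]
  [IsTopologicalGroup G] [T2Space G] [LocallyCompactSpace G] [SecondCountableTopology G]
  [MeasurableSpace G] [BorelSpace G] (μ : Measure G) [μ.IsHaarMeasure]
  {S : Type*} [NormedAddCommGroup S] [NormedSpace ℝ S]

variable (E) in
theorem exists_testFunction {U : Set G} (hU : U ∈ 𝓝 (1 : G)) :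
    ∃ φ : G → ℝ, ContMDiff 𝓘(ℝ, E) 𝓘(ℝ, ℝ) ∞ φ ∧ HasCompactSupport φ ∧ (∀ g, 0 ≤ φ g) ∧
      (∀ g ∉ U, φ g = 0) ∧ ∫ g, φ g ∂μ = 1 := by
  have : IsManifold 𝓘(ℝ, E) ∞ G := LieGroup.toContMDiffMul.toIsManifold
  obtain ⟨ρ, -, hρ⟩ := (SmoothBumpFunction.nhds_basis_support (I := 𝓘(ℝ, E)) hU).mem_iff.1 hU
  have hpos : 0 < ∫ g, ρ g ∂μ :=
    ρ.continuous.integral_pos_of_hasCompactSupport_nonneg_nonzero ρ.hasCompactSupport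
      (fun g => ρ.nonneg) (x := 1) (by rw [ρ.eq_one]; exact one_ne_zero)
  refine ⟨fun g => (∫ g, ρ g ∂μ)⁻¹ * ρ g, contMDiff_const.mul ρ.contMDiff,
    ρ.hasCompactSupport.mul_left, fun g => mul_nonneg (inv_nonneg.2 hpos.le) ρ.nonneg,
    fun g hg => ?_, ?_⟩
  · have : ρ g = 0 := by
      by_contra h
      exact hg (hρ h)
    simp [this]
  · rw [integral_const_mul, inv_mul_cancel₀ hpos.ne']

/-- Continuity at `g = 1`, made uniform in `x ∈ K` by the tube lemma. -/
theorem exists_nhds_one_norm_sub_le {H : G × G → S} (hH : Continuous H) {K : Set G}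
    (hK : IsCompact K) {η : ℝ} (hη : 0 < η) :
    ∃ U ∈ 𝓝 (1 : G), ∀ x ∈ K, ∀ g ∈ U, ‖H (x, g) - H (x, 1)‖ ≤ η := by
  have h1 : IsOpen {p : G × G | ‖H p - H (p.1, 1)‖ < η} :=
    isOpen_lt ((hH.sub (hH.comp (continuous_fst.prodMk continuous_const))).norm) continuous_const
  obtain ⟨u, v, hu, hv, hKu, h1v, huv⟩ := generalized_tube_lemma hK
    (isCompact_singleton (x := (1 : G))) h1 (by
      rintro ⟨x, g⟩ ⟨-, rfl⟩
      simpa using hη)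
  refine ⟨v, hv.mem_nhds (h1v rfl), fun x hx g hg => ?_⟩
  have h2 : (x, g) ∈ {p : G × G | ‖H p - H (p.1, 1)‖ < η} := huv ⟨hKu hx, hg⟩
  exact le_of_lt h2

/-- `φ` is a probability density vanishing off `U`, so the integral is an average of values within
`η` of `c`. -/
theorem norm_integral_smul_sub_le [CompleteSpace S] {φ : G → ℝ} (hφ : Continuous φ)
    (hφc : HasCompactSupport φ)
    (hφ0 : ∀ g, 0 ≤ φ g) {U : Set G} (hφU : ∀ g ∉ U, φ g = 0) (hφ1 : ∫ g, φ g ∂μ = 1)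
    {H : G → S} (hH : Continuous H) {c : S} {η : ℝ} (hU : ∀ g ∈ U, ‖H g - c‖ ≤ η) :
    ‖∫ g, φ g • H g ∂μ - c‖ ≤ η := by
  have hφi : Integrable φ μ := hφ.integrable_of_hasCompactSupport hφc
  have hHi : Integrable (fun g => φ g • H g) μ :=
    (hφ.smul hH).integrable_of_hasCompactSupport hφc.smul_right
  have h1 : ∫ g, φ g • H g ∂μ - c = ∫ g, φ g • (H g - c) ∂μ := by
    simp_rw [smul_sub]
    rw [integral_sub hHi (hφi.smul_const c), integral_smul_const, hφ1, one_smul]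
  rw [h1]
  calc ‖∫ g, φ g • (H g - c) ∂μ‖ ≤ ∫ g, φ g * η ∂μ := by
        refine norm_integral_le_of_norm_le (hφi.mul_const η)
          (Filter.Eventually.of_forall fun g => ?_)
        rw [norm_smul, Real.norm_of_nonneg (hφ0 g)]
        by_cases hg : g ∈ U
        · exact mul_le_mul_of_nonneg_left (hU g hg) (hφ0 g)
        · simp [hφU g hg]
    _ = η := by rw [integral_mul_const, hφ1, one_mul]

end ApproximateIdentity

/-! ### The Dirac operator on averages, and its transport by intertwiners. -/

section DiracMollify

variable {E : Type*} [NormedAddCommGroup E] [NormedSpace ℝ E] [FiniteDimensional ℝ E]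
  {G : Type*} [Group G] [TopologicalSpace G] [ChartedSpace E G] [LieGroup 𝓘(ℝ, E) ∞ G]
  [IsTopologicalGroup G] [T2Space G] [LocallyCompactSpace G] [SecondCountableTopology G]
  [MeasurableSpace G] [BorelSpace G] {μ : Measure G} [μ.IsHaarMeasure]
  {Γ : Subgroup G} [DiscreteTopology Γ]
  [CompactSpace (Quotient (QuotientGroup.rightRel Γ))] {ε : Γ →* ℤˣ}
  (m : Bundle.ContMDiffRiemannianMetric 𝓘(ℝ, E) ∞ E
      (fun x : G => TangentSpace 𝓘(ℝ, E) x)) {n : ℕ}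
  (e : Module.Basis (Fin n) ℝ (GroupLieAlgebra 𝓘(ℝ, E) G))
  {S : Type*} [NormedAddCommGroup S] [InnerProductSpace ℂ S] [FiniteDimensional ℂ S]
  (σ : SpinorModule n S) {φ : G → ℝ}

/-- Clifford multiplication as a continuous linear map. -/
def SpinorModule.γL (i : Fin n) : S →L[ℂ] S := (σ.γ i).toContinuousLinearMap

/-- The term of order zero of the Dirac operator. -/
def diracPotential : S →L[ℂ] S :=
  ∑ i, (σ.γL i).comp ((1 / 4 : ℂ) • ∑ j, ∑ k, (christoffel m e i j k : ℂ) • (σ.γL j).comp (σ.γL k))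

theorem diracOnG_eq (s : G → S) (g : G) : diracOnG m e σ s g =
    ∑ i, σ.γL i (leftInvariantDeriv (e i) s g) + diracPotential m e σ (s g) := by
  simp only [diracOnG, spinorConnection, diracPotential, map_add, Finset.sum_add_distrib,
    _root_.sum_apply, ContinuousLinearMap.comp_apply, _root_.smul_apply]
  rfl

/-- The operator `D R(φ)` on `L²_ε(Γ \ G; S)`, for a test function `φ`. -/
def diracMollifyL2 (hφ : ContMDiff 𝓘(ℝ, E) 𝓘(ℝ, ℝ) ∞ φ) (hφc : HasCompactSupport φ)
    (f : EquivL2 μ Γ ε S) : EquivL2 μ Γ ε S :=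
  ∑ i, postComp (σ.γL i) (mollifyL2 (contMDiff_translDeriv (E := E) (e i) hφ)
    (hasCompactSupport_translDeriv (E := E) (e i) hφc) f) +
  postComp (diracPotential m e σ) (mollifyL2 hφ hφc f)

theorem EquivL2.coeFn_sum {ι : Type*} (t : Finset ι) (F : ι → EquivL2 μ Γ ε S) :
    ((∑ i ∈ t, F i : EquivL2 μ Γ ε S) : G →ₘ[μ] S) =ᵐ[μ]
      fun x => ∑ i ∈ t, (F i : G →ₘ[μ] S) x := by
  classical
  induction t using Finset.induction_on with
  | empty => exact AEEqFun.coeFn_zero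
  | insert i t hi ih =>
    rw [Finset.sum_insert hi]
    refine (AEEqFun.coeFn_add _ _).trans ?_
    filter_upwards [ih] with x hx
    rw [Finset.sum_insert hi, Pi.add_apply, hx]

theorem diracMollifyL2_ae (hφ : ContMDiff 𝓘(ℝ, E) 𝓘(ℝ, ℝ) ∞ φ) (hφc : HasCompactSupport φ)
    (f : EquivL2 μ Γ ε S) : (diracMollifyL2 m e σ hφ hφc f : G →ₘ[μ] S) =ᵐ[μ]
      diracOnG m e σ (mollify μ φ (f : G →ₘ[μ] S)) := by
  refine (AEEqFun.coeFn_add _ _).trans ?_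
  have h1 : ∀ᵐ x ∂μ, ∀ i, (postComp (σ.γL i) (mollifyL2 (contMDiff_translDeriv (E := E) (e i) hφ)
      (hasCompactSupport_translDeriv (E := E) (e i) hφc) f) : G →ₘ[μ] S) x =
        σ.γL i (mollify μ (translDeriv E (e i) φ) (f : G →ₘ[μ] S) x) := by
    refine ae_all_iff.2 fun i => ?_
    filter_upwards [postComp_ae (σ.γL i) (mollifyL2 (contMDiff_translDeriv (E := E) (e i) hφ)
      (hasCompactSupport_translDeriv (E := E) (e i) hφc) f), mollifyL2_ae (contMDiff_translDeriv (E := E) (e i) hφ)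
      (hasCompactSupport_translDeriv (E := E) (e i) hφc) f] with x h1 h2
    rw [h1, h2]
  filter_upwards [h1, EquivL2.coeFn_sum Finset.univ fun i => postComp (σ.γL i)
      (mollifyL2 (contMDiff_translDeriv (E := E) (e i) hφ) (hasCompactSupport_translDeriv (E := E) (e i) hφc) f),
    postComp_ae (diracPotential m e σ) (mollifyL2 hφ hφc f), mollifyL2_ae hφ hφc f]
    with x h1 h2 h3 h4
  rw [diracOnG_eq, Pi.add_apply, h2, h3, h4]
  congr 1
  refine Finset.sum_congr rfl fun i _ => ?_
  rw [h1, leftInvariantDeriv_mollify μ (e i) hφ hφc f.locallyIntegrable]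

theorem mollifyL2_mem_smoothDiracGraph (hφ : ContMDiff 𝓘(ℝ, E) 𝓘(ℝ, ℝ) ∞ φ)
    (hφc : HasCompactSupport φ) (f : EquivL2 μ Γ ε S) :
    (mollifyL2 hφ hφc f, diracMollifyL2 m e σ hφ hφc f) ∈ smoothDiracGraph m e μ Γ ε σ :=
  ⟨mollify μ φ (f : G →ₘ[μ] S), contMDiff_mollify μ hφ hφc f.locallyIntegrable,
    mollifyL2_ae hφ hφc f, diracMollifyL2_ae m e σ hφ hφc f⟩

/-- `D R(φ)` is assembled only from averaging operators and pointwise linear maps, with both of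
which `T` commutes. -/
theorem map_diracMollifyL2 {Γ' : Subgroup G} [DiscreteTopology Γ']
    [CompactSpace (Quotient (QuotientGroup.rightRel Γ'))] {ε' : Γ' →* ℤˣ}
    (hφ : ContMDiff 𝓘(ℝ, E) 𝓘(ℝ, ℝ) ∞ φ) (hφc : HasCompactSupport φ)
    (T : EquivL2 μ Γ ε S →L[ℂ] EquivL2 μ Γ' ε' S)
    (hT : ∀ g f, T (rightRegular μ Γ ε S g f) = rightRegular μ Γ' ε' S g (T f))
    (hTA : ∀ (A : S →L[ℂ] S) f, T (postComp A f) = postComp A (T f))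
    (f : EquivL2 μ Γ ε S) :
    T (diracMollifyL2 m e σ hφ hφc f) = diracMollifyL2 m e σ hφ hφc (T f) := by
  have : CompleteSpace S := FiniteDimensional.complete ℂ S
  simp only [diracMollifyL2, map_add, map_sum, hTA, map_mollifyL2 _ _ T hT]

/-- The Dirac operator applied to the right translates of `s`. -/
def translateDirac (s : G → S) (p : G × G) : S :=
  ∑ i, σ.γL i (translateDeriv E (e i) s p.1 p.2) + diracPotential m e σ (s (p.1 * p.2))

theorem continuous_translateDirac {s : G → S} (hs : ContMDiff 𝓘(ℝ, E) 𝓘(ℝ, S) ∞ s) :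
    Continuous (translateDirac m e σ s) :=
  (continuous_finsetSum _ fun i _ => (σ.γL i).continuous.comp
    (continuous_translateDeriv (E := E) (e i) hs)).add
  ((diracPotential m e σ).continuous.comp (hs.continuous.comp continuous_mul))

theorem translateDirac_one {s : G → S} (hs : ContMDiff 𝓘(ℝ, E) 𝓘(ℝ, S) ∞ s) (x : G) :
    translateDirac m e σ s (x, 1) = diracOnG m e σ s x := by
  rw [diracOnG_eq, translateDirac, mul_one]
  congr 1
  exact Finset.sum_congr rfl fun i _ => by rw [translateDeriv_one (e i) hs]

/-- Exhibits `D R(φ) s` as a `φ`-average of a continuous function whose value at `g = 1` is `D s`,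
by `translateDirac_one`; convergence in the second component of the graph then follows as in the
first. -/
theorem diracOnG_mollify (hφ : ContMDiff 𝓘(ℝ, E) 𝓘(ℝ, ℝ) ∞ φ) (hφc : HasCompactSupport φ)
    {s : G → S} (hs : ContMDiff 𝓘(ℝ, E) 𝓘(ℝ, S) ∞ s) (x : G) :
    diracOnG m e σ (mollify μ φ s) x = ∫ g, φ g • translateDirac m e σ s (x, g) ∂μ := by
  have : CompleteSpace S := FiniteDimensional.complete ℂ S
  have hint : ∀ {H : G → S}, Continuous H → Integrable (fun g => φ g • H g) μ := fun hH =>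
    (hφ.continuous.smul hH).integrable_of_hasCompactSupport hφc.smul_right
  have hcomp : ∀ (A : S →L[ℂ] S) {H : G → S}, Continuous H →
      A (∫ g, φ g • H g ∂μ) = ∫ g, φ g • A (H g) ∂μ := by
    intro A H hH
    rw [← A.integral_comp_comm (hint hH)]
    refine integral_congr_ae (Filter.Eventually.of_forall fun g => ?_)
    exact (A.restrictScalars ℝ).map_smul _ _
  have hd : ∀ i, Continuous fun g => translateDeriv E (e i) s x g := fun i =>
    (continuous_translateDeriv (E := E) (e i) hs).comp (continuous_const.prodMk continuous_id)
  have hsx : Continuous fun g => s (x * g) := hs.continuous.comp (continuous_const_mul x)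
  rw [diracOnG_eq]
  simp only [translateDirac, smul_add, Finset.smul_sum]
  have hi : ∀ i ∈ Finset.univ,
      Integrable (fun g => φ g • σ.γL i (translateDeriv E (e i) s x g)) μ :=
    fun i _ => hint ((σ.γL i).continuous.comp (hd i))
  have hp : Integrable (fun g => φ g • diracPotential m e σ (s (x * g))) μ :=
    hint ((diracPotential m e σ).continuous.comp hsx)
  rw [integral_add (integrable_finsetSum _ hi) hp, integral_finsetSum _ hi,
    mollify_eq_integral_mul, hcomp _ hsx]
  congr 1
  refine Finset.sum_congr rfl fun i _ => ?_
  rw [leftInvariantDeriv_mollify_of_contMDiff μ (e i) hφ hφc hs, hcomp _ (hd i)]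

/-- Smooth spinors are approximated, in the graph norm of the Dirac operator, by averages of their
right translates. -/
theorem exists_mollifyL2_close {p : EquivL2 μ Γ ε S × EquivL2 μ Γ ε S}
    (hp : p ∈ smoothDiracGraph m e μ Γ ε σ) {δ : ℝ} (hδ : 0 < δ) :
    ∃ (φ : G → ℝ) (hφ : ContMDiff 𝓘(ℝ, E) 𝓘(ℝ, ℝ) ∞ φ) (hφc : HasCompactSupport φ),
      dist p (mollifyL2 hφ hφc p.1, diracMollifyL2 m e σ hφ hφc p.1) < δ := by
  have : CompleteSpace S := FiniteDimensional.complete ℂ S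
  obtain ⟨s, hs, hs1, hs2⟩ := hp
  obtain ⟨M, hM, hMb⟩ := EquivL2.exists_norm_le_of_bound μ Γ ε S
  obtain ⟨⟨K, hK, hFK⟩, -⟩ := fundDomain_spec μ Γ
  obtain ⟨η, hη, hηδ⟩ : ∃ η : ℝ, 0 < η ∧ M * η < δ := by
    refine ⟨δ / (M + 1), by positivity, ?_⟩
    rw [← mul_div_assoc, div_lt_iff₀ (by positivity)]
    nlinarith
  have hsc : Continuous fun p : G × G => s (p.1 * p.2) := hs.continuous.comp continuous_mul
  have hdc := continuous_translateDirac m e σ hs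
  obtain ⟨U, hU, hUs⟩ := exists_nhds_one_norm_sub_le hsc hK hη
  obtain ⟨U', hU', hUd⟩ := exists_nhds_one_norm_sub_le hdc hK hη
  -- A single `φ`, vanishing off both neighbourhoods, serves the spinor and its image under `D`; the
  -- distance on the product is the maximum of the two distances.
  obtain ⟨φ, hφ, hφc, hφ0, hφU, hφ1⟩ := exists_testFunction E μ (Filter.inter_mem hU hU')
  have hmol : mollify μ φ (p.1 : G →ₘ[μ] S) = mollify μ φ s := mollify_congr_ae hs1 φ
  refine ⟨φ, hφ, hφc, max_lt ?_ ?_⟩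
  · rw [dist_comm, dist_eq_norm]
    refine (hMb _ η hη.le ?_).trans_lt hηδ
    filter_upwards [AEEqFun.coeFn_sub (mollifyL2 hφ hφc p.1 : G →ₘ[μ] S) p.1,
      mollifyL2_ae hφ hφc p.1, hs1] with x h1 h2 h3 hx
    refine (congrArg norm h1).trans_le ?_
    rw [Pi.sub_apply, h2, h3, hmol, mollify_eq_integral_mul]
    refine norm_integral_smul_sub_le μ hφ.continuous hφc hφ0 hφU hφ1
      (hs.continuous.comp (continuous_const_mul x)) fun g hg => ?_
    simpa using hUs x (hFK hx) g hg.1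
  · rw [dist_comm, dist_eq_norm]
    refine (hMb _ η hη.le ?_).trans_lt hηδ
    filter_upwards [AEEqFun.coeFn_sub (diracMollifyL2 m e σ hφ hφc p.1 : G →ₘ[μ] S) p.2,
      diracMollifyL2_ae m e σ hφ hφc p.1, hs2] with x h1 h2 h3 hx
    refine (congrArg norm h1).trans_le ?_
    rw [Pi.sub_apply, h2, h3, hmol, diracOnG_mollify m e σ hφ hφc hs]
    refine norm_integral_smul_sub_le μ hφ.continuous hφc hφ0 hφU hφ1
      (hdc.comp (continuous_const.prodMk continuous_id)) fun g hg => ?_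
    rw [← translateDirac_one m e σ hs]
    exact hUd x (hFK hx) g hg.2

/-- Intertwiners that commute with pointwise linear maps commute with the Dirac operators. -/
theorem map_mem_diracOperator {Γ' : Subgroup G} [DiscreteTopology Γ']
    [CompactSpace (Quotient (QuotientGroup.rightRel Γ'))] {ε' : Γ' →* ℤˣ}
    (T : EquivL2 μ Γ ε S →L[ℂ] EquivL2 μ Γ' ε' S)
    (hT : ∀ g f, T (rightRegular μ Γ ε S g f) = rightRegular μ Γ' ε' S g (T f))
    (hTA : ∀ (A : S →L[ℂ] S) f, T (postComp A f) = postComp A (T f))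
    {p : EquivL2 μ Γ ε S × EquivL2 μ Γ ε S} (hp : p ∈ diracOperator m e μ Γ ε σ) :
    (T p.1, T p.2) ∈ diracOperator m e μ Γ' ε' σ := by
  have : CompleteSpace S := FiniteDimensional.complete ℂ S
  -- For smooth `q.1` nothing is known yet about smoothness of `T q.1`. The averaged pairs do lie in
  -- `P`, since averaging commutes with `T` and makes every class smooth, and they approximate `q`.
  let P : Set (EquivL2 μ Γ ε S × EquivL2 μ Γ ε S) :=
    {q | (T q.1, T q.2) ∈ smoothDiracGraph m e μ Γ' ε' σ}
  have hsub : (smoothDiracGraph m e μ Γ ε σ : Set (EquivL2 μ Γ ε S × EquivL2 μ Γ ε S)) ⊆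
      closure P := by
    intro q hq
    refine Metric.mem_closure_iff.2 fun δ hδ => ?_
    obtain ⟨φ, hφ, hφc, h⟩ := exists_mollifyL2_close m e σ hq hδ
    refine ⟨_, ?_, h⟩
    change (T (mollifyL2 hφ hφc q.1), T (diracMollifyL2 m e σ hφ hφc q.1)) ∈
      smoothDiracGraph m e μ Γ' ε' σ
    rw [map_mollifyL2 hφ hφc T hT, map_diracMollifyL2 m e σ hφ hφc T hT hTA]
    exact mollifyL2_mem_smoothDiracGraph m e σ hφ hφc _
  have hp' : p ∈ closure P := closure_minimal hsub isClosed_closure hp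
  exact map_mem_closure (f := fun q : EquivL2 μ Γ ε S × EquivL2 μ Γ ε S => (T q.1, T q.2))
    ((T.continuous.comp continuous_fst).prodMk (T.continuous.comp continuous_snd)) hp'
    fun q hq => hq

end DiracMollify

end DiracNil

end

/-! ### Isospectrality of the two Dirac operators. -/

theorem theorem5p1
    {E : Type*} [NormedAddCommGroup E] [NormedSpace ℝ E] [FiniteDimensional ℝ E]
    {G : Type*} [Group G] [TopologicalSpace G] [IsTopologicalGroup G] [T2Space G]
    [LocallyCompactSpace G] [SecondCountableTopology G] [MeasurableSpace G] [BorelSpace G]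
    [ChartedSpace E G] [LieGroup 𝓘(ℝ, E) ∞ G] [SimplyConnectedSpace G] [Group.IsNilpotent G]
    (μ : Measure G) [μ.IsHaarMeasure]
    (Γ : Subgroup G) [DiscreteTopology Γ] [CompactSpace (Quotient (QuotientGroup.rightRel Γ))]
    (ε : Γ →* ℤˣ)
    (Γ' : Subgroup G) [DiscreteTopology Γ'] [CompactSpace (Quotient (QuotientGroup.rightRel Γ'))]
    (ε' : Γ' →* ℤˣ)
    (hequiv : DiracNil.RepresentationEquivalent μ Γ ε Γ' ε')
    (m : Bundle.ContMDiffRiemannianMetric 𝓘(ℝ, E) ∞ E (fun x : G => TangentSpace 𝓘(ℝ, E) x))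
    (hm : DiracNil.IsLeftInvariantMetric m)
    {n : ℕ} (e : Module.Basis (Fin n) ℝ (GroupLieAlgebra 𝓘(ℝ, E) G))
    (he : DiracNil.IsOrthonormalFrame m e)
    {S : Type*} [NormedAddCommGroup S] [InnerProductSpace ℂ S] (σ : DiracNil.SpinorModule n S) :
    DiracNil.spectrumOfGraph (DiracNil.diracOperator m e μ Γ ε σ) =
        DiracNil.spectrumOfGraph (DiracNil.diracOperator m e μ Γ' ε' σ) ∧
      ∀ z : ℂ,
        Module.rank ℂ (DiracNil.eigenspaceOfGraph (DiracNil.diracOperator m e μ Γ ε σ) z) =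
          Module.rank ℂ (DiracNil.eigenspaceOfGraph (DiracNil.diracOperator m e μ Γ' ε' σ) z) := by
  have : FiniteDimensional ℂ S :=
    Module.finite_of_finrank_pos (by rw [σ.finrank_eq]; positivity)
  obtain ⟨θ, hθ⟩ := hequiv
  have hθ' : ∀ (g : G) (f : DiracNil.EquivL2 μ Γ' ε' ℂ),
      θ.symm (DiracNil.rightRegular μ Γ' ε' ℂ g f) =
        DiracNil.rightRegular μ Γ ε ℂ g (θ.symm f) := fun g f => by
    rw [θ.symm_apply_eq, hθ, θ.apply_symm_apply]
  let T := DiracNil.tensorId S (θ : DiracNil.EquivL2 μ Γ ε ℂ →L[ℂ] DiracNil.EquivL2 μ Γ' ε' ℂ)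
  let T' := DiracNil.tensorId S
    (θ.symm : DiracNil.EquivL2 μ Γ' ε' ℂ →L[ℂ] DiracNil.EquivL2 μ Γ ε ℂ)
  have hT'T : Function.LeftInverse T' T := DiracNil.tensorId_leftInverse _ _ θ.symm_apply_apply
  let Θ : DiracNil.EquivL2 μ Γ ε S ≃L[ℂ] DiracNil.EquivL2 μ Γ' ε' S :=
    ContinuousLinearEquiv.equivOfInverse T T' hT'T
      (DiracNil.tensorId_leftInverse _ _ θ.apply_symm_apply)
  have hΘ : ∀ f h, (f, h) ∈ DiracNil.diracOperator m e μ Γ ε σ ↔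
      (Θ f, Θ h) ∈ DiracNil.diracOperator m e μ Γ' ε' σ := by
    refine fun f h => ⟨fun hfh => ?_, fun hfh => ?_⟩
    · exact DiracNil.map_mem_diracOperator m e σ T (DiracNil.tensorId_rightRegular _ hθ)
        (DiracNil.tensorId_postComp _) hfh
    -- The converse inclusion of graphs comes from the inverse intertwiner, undone by `T' ∘ T = id`.
    · have h1 := DiracNil.map_mem_diracOperator m e σ T' (DiracNil.tensorId_rightRegular _ hθ')
        (DiracNil.tensorId_postComp _) hfh
      have h2 : (T' (T f), T' (T h)) ∈ DiracNil.diracOperator m e μ Γ ε σ := h1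
      rwa [hT'T f, hT'T h] at h2
  exact ⟨DiracNil.spectrumOfGraph_eq Θ hΘ,
    fun z => (DiracNil.eigenspaceOfGraphEquiv Θ hΘ z).rank_eq⟩
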